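/- Let $n,m\ge 0$ be integers, $A\in\mathbb R^{n\times n}$, $B\in\mathbb R^{n\times m}$, $b\in\mathbb R^n$ and $f:\mathbb R^n\times\mathbb R^m\to\mathbb R$. **The control problem.** For $T>0$ and $x\in\mathbb R^n$ let $$V_T(x)=\inf_{u\in L^2(0,T;\mathbb R^m)}\int_0^T f(X(t),u(t))\,dt ,$$ where $X$ is the solution of $\dot X(t)=AX(t)+Bu(t)+b$ on $[0,T]$ with $X(0)=x$. **Decomposition.** Let $\mathscr C=\operatorname{im}(B,AB,\dots,A^{n-1}B)$ be the controllable subspace, $k=\dim\mathscr C$, let $P_2\in\mathbb R^{n\times(n-k)}$ be a matrix whose columns form an orthonormal basis of $\mathscr C^\perp$, and put $A_{22}=P_2^\top AP_2$. Let $$\mathscr G_1=\Big(\bigoplus_{\lambda\in\sigma(A_{22}),\ \operatorname{Re}\lambda<0}G(\lambda,A_{22})\Big)\cap\mathbb R^{n-k},\qquad \mathscr G_2=\ker A_{22}\subseteq\mathbb R^{n-k},$$ where $G(\lambda,A_{22})\subseteq\mathbb C^{n-k}$ is the generalized eigenspace of $A_{22}$ for the eigenvalue $\lambda\in\mathbb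 C$. Then $\mathscr G_1\cap\mathscr G_2=\{0\}$; let $Q_2:\mathscr G_1\oplus\mathscr G_2\to\mathscr G_2$ be the projection along $\mathscr G_1$. **Assumptions.** (A1) $b\in\operatorname{im}(A,B)$; equivalently, there is $c\in\mathbb R^{n-k}$ with $A_{22}c=P_2^\top b$. Fix any such $c$. (A2) $f\in C^2(\mathbb R^n\times\mathbb R^m)$, and there is $\delta>0$ with $\nabla^2f(x,u)\ge\delta I_{n+m}$ for all $(x,u)\in\mathbb R^n\times\mathbb R^m$. **The static problem.** Let $\mathscr X=\{x\in\mathbb R^n: P_2^\top x+c\in\mathscr G_1\oplus\mathscr G_2\}$, and for $x\in\mathscr X$ let $$\mathscr V_x=\{(z,u)\in\mathbb R^n\times\mathbb R^m:\ Az+Bu+b=0,\ P_2^\top z+c=Q_2(P_2^\top x+c)\},\qquad V^*(x)=\inf_{(z,u)\in\mathscr V_x}f(z,u).$$ **Theorem.** Under (A1)–(A2), for every $x\in\mathscr X$ the values $V^*(x)$ and $V_T(x)$, $T>0$, are finite, and there is a constant $K>0$, independent of $T$, such that $$|V_T(x)-T\,V^*(x)|\le K\qquad\text{for all }T>0 .$$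 Consequently $\frac1T V_T(x)-V^*(x)=O\big(\frac1T\big)$ as $T\to\infty$. -/

import Mathlib

open Matrix MeasureTheory Set

noncomputable section

namespace Turnpike

/-- The Euclidean space `ℝⁿ`. -/
abbrev E (n : ℕ) : Type := EuclideanSpace ℝ (Fin n)

/-! ### Linear algebra -/

/-- The controllable subspace `im (B, AB, …, Aⁿ⁻¹B)` of the pair `(A, B)`. -/
def controllableSubspace {n m : ℕ} (A : Matrix (Fin n) (Fin n) ℝ) (B : Matrix (Fin n) (Fin m) ℝ) :
    Submodule ℝ (E n) :=
  ⨆ i : Fin n, LinearMap.range (toEuclideanLin (A ^ (i : ℕ) * B))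

/-- The matrix whose columns are the members of a family of vectors that lie in a subspace. -/
def columns {n l : ℕ} {S : Submodule ℝ (E n)} (v : Fin l → S) : Matrix (Fin n) (Fin l) ℝ :=
  Matrix.of fun i j => (v j : E n) i

/-- The inclusion `ℝˡ → ℂˡ`. -/
def complexify (l : ℕ) : E l →ₗ[ℝ] (Fin l → ℂ) where
  toFun y := fun i => (y i : ℂ)
  map_add' y z := by ext i; simp
  map_smul' r y := by ext i; simp

/-- `(⨁ G(μ, M)) ∩ ℝˡ`, the sum being over the `μ ∈ σ(M)` with `Re μ < 0`, where `G(μ, M) ⊆ ℂˡ` is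
the generalized eigenspace of the real matrix `M` for the complex eigenvalue `μ`. -/
def stableSubspace {l : ℕ} (M : Matrix (Fin l) (Fin l) ℝ) : Submodule ℝ (E l) :=
  ((⨆ μ ∈ spectrum ℂ (M.map Complex.ofReal) ∩ {μ : ℂ | μ.re < 0},
    Module.End.maxGenEigenspace (toLin' (M.map Complex.ofReal)) μ).restrictScalars ℝ).comap
      (complexify l)

/-- The kernel of `M` in `ℝˡ`. -/
def kernel {l : ℕ} (M : Matrix (Fin l) (Fin l) ℝ) : Submodule ℝ (E l) :=
  LinearMap.ker (toEuclideanLin M)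

theorem disjoint_stableSubspace_kernel {l : ℕ} (M : Matrix (Fin l) (Fin l) ℝ) :
    Disjoint (stableSubspace M) (kernel M) := by
  rw [Submodule.disjoint_def]
  intro y h1 h2
  set F := toLin' (M.map Complex.ofReal) with hF
  have h3 : complexify l y ∈ Module.End.maxGenEigenspace F 0 := by
    rw [Module.End.mem_maxGenEigenspace]
    refine ⟨1, ?_⟩
    have h4 : M *ᵥ (y : Fin l → ℝ) = 0 := by
      exact congrArg WithLp.ofLp (LinearMap.mem_ker.1 h2)
    ext i
    have h5 := congrFun h4 i
    simp only [mulVec, dotProduct, Pi.zero_apply] at h5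
    simp only [hF, zero_smul, sub_zero, pow_one, toLin'_apply, mulVec, dotProduct, map_apply,
      complexify, LinearMap.coe_mk, AddHom.coe_mk, Pi.zero_apply]
    exact_mod_cast h5
  have h6 : complexify l y ∈ ⨆ μ, ⨆ (_ : μ ≠ 0), Module.End.maxGenEigenspace F μ := by
    have h7 : (⨆ μ ∈ spectrum ℂ (M.map Complex.ofReal) ∩ {μ : ℂ | μ.re < 0},
        Module.End.maxGenEigenspace F μ) ≤
        ⨆ μ, ⨆ (_ : μ ≠ 0), Module.End.maxGenEigenspace F μ := by
      refine iSup₂_le fun μ hμ => ?_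
      have h8 : μ ≠ 0 := by
        rintro rfl
        have := hμ.2
        simp at this
      exact le_iSup₂_of_le μ h8 le_rfl
    exact h7 h1
  have h9 := (Submodule.disjoint_def.1 (Module.End.independent_maxGenEigenspace F 0)) _ h3 h6
  ext i
  have := congrFun h9 i
  simpa [complexify] using this

theorem isCompl_kernel_stableSubspace {l : ℕ} (M : Matrix (Fin l) (Fin l) ℝ) :
    IsCompl ((kernel M).submoduleOf (stableSubspace M ⊔ kernel M))
      ((stableSubspace M).submoduleOf (stableSubspace M ⊔ kernel M)) := by
  constructor
  · rw [Submodule.disjoint_def]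
    intro y h1 h2
    ext1
    exact (Submodule.disjoint_def.1 (disjoint_stableSubspace_kernel M)) _ h2 h1
  · rw [codisjoint_iff, eq_top_iff]
    rintro ⟨y, hy⟩ -
    obtain ⟨y₁, h₁, y₂, h₂, rfl⟩ := Submodule.mem_sup.1 hy
    refine Submodule.mem_sup.2 ⟨⟨y₂, Submodule.mem_sup_right h₂⟩, h₂,
      ⟨y₁, Submodule.mem_sup_left h₁⟩, h₁, ?_⟩
    ext1
    exact add_comm y₂ y₁

/-- The projection of the direct sum `stableSubspace M ⊕ kernel M` onto its second summand
`kernel M`, along `stableSubspace M`, as a map with values in `ℝˡ`. -/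
def kernelProj {l : ℕ} (M : Matrix (Fin l) (Fin l) ℝ) :
    ↥(stableSubspace M ⊔ kernel M) →ₗ[ℝ] E l :=
  (stableSubspace M ⊔ kernel M).subtype ∘ₗ
    Submodule.projection _ _ (isCompl_kernel_stableSubspace M)

/-! ### The static problem

Throughout, `P₂` is an `n × l` matrix (its columns will be an orthonormal basis of the orthogonal
complement of the controllable subspace), and `c ∈ ℝˡ`. -/

/-- The block `A₂₂ = P₂ᵀ A P₂`. -/
def uncontrollableBlock {n l : ℕ} (A : Matrix (Fin n) (Fin n) ℝ) (P₂ : Matrix (Fin n) (Fin l) ℝ) :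
    Matrix (Fin l) (Fin l) ℝ :=
  P₂ᵀ * A * P₂

/-- The set `𝒳` of feasible initial states: those `x` with
`P₂ᵀ x + c ∈ stableSubspace A₂₂ ⊕ kernel A₂₂`. -/
def feasibleStates {n l : ℕ} (A : Matrix (Fin n) (Fin n) ℝ) (P₂ : Matrix (Fin n) (Fin l) ℝ)
    (c : E l) : Set (E n) :=
  {x | toEuclideanLin P₂ᵀ x + c ∈ stableSubspace (uncontrollableBlock A P₂) ⊔
    kernel (uncontrollableBlock A P₂)}

/-- The set `𝒱ₓ` of all `(z, u)` with `A z + B u + b = 0` and `P₂ᵀ z + c = Q₂ (P₂ᵀ x + c)`,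
where `Q₂ = kernelProj A₂₂`. -/
def steadyPairs {n m l : ℕ} (A : Matrix (Fin n) (Fin n) ℝ) (B : Matrix (Fin n) (Fin m) ℝ) (b : E n)
    (P₂ : Matrix (Fin n) (Fin l) ℝ) (c : E l) (x : E n) (hx : x ∈ feasibleStates A P₂ c) :
    Set (E n × E m) :=
  {p | toEuclideanLin A p.1 + toEuclideanLin B p.2 + b = 0 ∧
    toEuclideanLin P₂ᵀ p.1 + c =
      kernelProj (uncontrollableBlock A P₂) ⟨toEuclideanLin P₂ᵀ x + c, hx⟩}

/-- The static value `V*(x) = inf_{(z, u) ∈ 𝒱ₓ} f (z, u)`. -/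
def staticValue {n m l : ℕ} (A : Matrix (Fin n) (Fin n) ℝ) (B : Matrix (Fin n) (Fin m) ℝ) (b : E n)
    (f : E n × E m → ℝ) (P₂ : Matrix (Fin n) (Fin l) ℝ) (c : E l) (x : E n)
    (hx : x ∈ feasibleStates A P₂ c) : EReal :=
  ⨅ p ∈ steadyPairs A B b P₂ c x hx, (f p : EReal)

/-! ### The optimal control problem -/

/-- `X` is the state trajectory on `[0, T]` for the control `u` and the initial state `x`: it is a
(Carathéodory) solution of `X' = A X + B u + b`, `X 0 = x`. -/
def IsTrajectory {n m : ℕ} (A : Matrix (Fin n) (Fin n) ℝ) (B : Matrix (Fin n) (Fin m) ℝ) (b : E n)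
    (x : E n) (T : ℝ) (u : ℝ → E m) (X : ℝ → E n) : Prop :=
  ContinuousOn X (Icc 0 T) ∧
    ∀ t ∈ Icc 0 T, X t = x + ∫ s in 0..t, (toEuclideanLin A (X s) + toEuclideanLin B (u s) + b)

/-- The cost `∫₀ᵀ f (X t, u t) dt`. For `f` continuous and bounded below (which holds for the
strongly convex functions considered here), the only way in which the integral of `f (X t, u t)` can
fail to converge is that it equals `+∞`. -/
def cost {n m : ℕ} (f : E n × E m → ℝ) (T : ℝ) (u : ℝ → E m) (X : ℝ → E n) : EReal :=
  open Classical in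
  if IntervalIntegrable (fun t => f (X t, u t)) volume 0 T then
    ((∫ t in 0..T, f (X t, u t) : ℝ) : EReal)
  else ⊤

/-- The value `V_T(x)`: the infimum of the cost over all controls `u ∈ L²(0, T; ℝᵐ)`, each with its
(unique) trajectory `X`. -/
def valueFunction {n m : ℕ} (A : Matrix (Fin n) (Fin n) ℝ) (B : Matrix (Fin n) (Fin m) ℝ) (b : E n)
    (f : E n × E m → ℝ) (T : ℝ) (x : E n) : EReal :=
  ⨅ (u : ℝ → E m) (_ : MemLp u 2 (volume.restrict (Icc 0 T))) (X : ℝ → E n)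
    (_ : IsTrajectory A B b x T u X), cost f T u X

/-- `f` is of class `C²` and `∇² f ≥ δ I` everywhere, for some `δ > 0`. -/
def IsStronglyConvexC2 {n m : ℕ} (f : E n × E m → ℝ) : Prop :=
  ContDiff ℝ 2 f ∧ ∃ δ : ℝ, 0 < δ ∧ ∀ p w : E n × E m,
    δ * (‖w.1‖ ^ 2 + ‖w.2‖ ^ 2) ≤ fderiv ℝ (fderiv ℝ f) p w w

end Turnpike

end

noncomputable section
namespace Turnpike

variable {n m l : ℕ}

/-! Let `p = (z, u₀)` minimize `f` over the steady pairs. The constraint `P₂ᵀ z + c = Q₂ (P₂ᵀ x +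
c)` puts `P₂ᵀ (x - z)` in the stable subspace of `A₂₂`, so `x - z` can be steered to zero by a
control `w` such that `w` and the trajectory `ξ` decay exponentially (`exists_decaying_trajectory`).
Everything follows by comparison with `ξ`.

Upper bound (`exists_valueFunction_le`): `(z + ξ, u₀ + w)` is admissible and stays in a ball where
`f` is Lipschitz, so its cost exceeds `T f(p)` by at most a multiple of `∫ (‖ξ‖ + ‖w‖)`.

Lower bound (`exists_le_cost`): by `exists_multipliers`, the derivative of `f` at `p` is `ψ₁ (A · +
B ·) + ψ₂ (P₂ᵀ ·)`. Hence strong convexity gives, along any trajectory, `f(X, u) ≥ f(p) + ψ₁(X') +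
ψ₂(P₂ᵀ(X - z)) + (δ/2)(‖X - z‖² + ‖u - u₀‖²)`. The `ψ₁` term integrates to `ψ₁(X(T) - x)`, which the
quadratic term absorbs by `norm_endpoint_sub_le`. In the `ψ₂` term `P₂ᵀ(X - z) = P₂ᵀ ξ` whatever the
control, so its integral is bounded.

Steering uses no feedback matrix. The states that can be steered to zero with exponential decay form
a subspace, and `mem_decayingStates_of_sub` enlarges it step by step: to the controllable subspace
by a resolvent limit, then along the Jordan chains of the stable eigenvalues. -/

/-! ### The controllable subspace and its invariance. -/

theorem range_pow_mul_le_controllableSubspace (A : Matrix (Fin n) (Fin n) ℝ)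
    (B : Matrix (Fin n) (Fin m) ℝ) (k : ℕ) :
    LinearMap.range (toEuclideanLin (A ^ k * B)) ≤ controllableSubspace A B := by
  -- For `n = 0` the characteristic polynomial is `1`, and the strict degree bound on remainders
  -- below fails.
  rcases Nat.eq_zero_or_pos n with rfl | hn
  · intro y _
    rw [Subsingleton.elim y 0]
    exact zero_mem _
  have hdeg : A.charpoly.natDegree = n := by simp [Matrix.charpoly_natDegree_eq_dim]
  -- Cayley–Hamilton: `A ^ k` is a combination of the powers below `n`.
  have key : A ^ k = Polynomial.aeval A (Polynomial.X ^ k %ₘ A.charpoly) := by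
    rw [Matrix.pow_eq_aeval_mod_charpoly]
  have hlt : (Polynomial.X ^ k %ₘ A.charpoly).natDegree < n := by
    have := Polynomial.natDegree_modByMonic_lt (Polynomial.X ^ k) A.charpoly_monic
      (by intro h; rw [h] at hdeg; simp at hdeg; omega)
    omega
  rintro _ ⟨w, rfl⟩
  rw [key, Polynomial.aeval_eq_sum_range' hlt, Matrix.sum_mul, map_sum, LinearMap.sum_apply]
  refine Submodule.sum_mem _ fun i hi => ?_
  rw [smul_mul, map_smul, LinearMap.smul_apply]
  refine Submodule.smul_mem _ _ ?_
  exact Submodule.mem_iSup_of_mem (p := fun i : Fin n =>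
    LinearMap.range (toEuclideanLin (A ^ (i : ℕ) * B))) ⟨i, Finset.mem_range.1 hi⟩ ⟨w, rfl⟩

theorem toEuclideanLin_mul_apply {a b c : ℕ} (M : Matrix (Fin a) (Fin b) ℝ)
    (N : Matrix (Fin b) (Fin c) ℝ) (y : E c) :
    toEuclideanLin (M * N) y = toEuclideanLin M (toEuclideanLin N y) := by
  ext i
  simp [toLpLin_apply, Matrix.mulVec_mulVec]

theorem mulVec_mem_controllableSubspace (A : Matrix (Fin n) (Fin n) ℝ)
    (B : Matrix (Fin n) (Fin m) ℝ) {y : E n} (hy : y ∈ controllableSubspace A B) :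
    toEuclideanLin A y ∈ controllableSubspace A B := by
  suffices h : controllableSubspace A B ≤
      (controllableSubspace A B).comap (toEuclideanLin A) from h hy
  refine iSup_le fun i => ?_
  rintro _ ⟨w, rfl⟩
  rw [Submodule.mem_comap, ← toEuclideanLin_mul_apply, ← Matrix.mul_assoc, ← pow_succ']
  exact range_pow_mul_le_controllableSubspace A B _ ⟨w, rfl⟩

theorem range_le_controllableSubspace (A : Matrix (Fin n) (Fin n) ℝ)
    (B : Matrix (Fin n) (Fin m) ℝ) (w : E m) :
    toEuclideanLin B w ∈ controllableSubspace A B := by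
  simpa using range_pow_mul_le_controllableSubspace A B 0 ⟨w, rfl⟩

/-- Every controllable state has the form `A y + B w` with `y` controllable. -/
theorem controllableSubspace_le (A : Matrix (Fin n) (Fin n) ℝ) (B : Matrix (Fin n) (Fin m) ℝ) :
    controllableSubspace A B ≤
      (controllableSubspace A B).map (toEuclideanLin A) ⊔ LinearMap.range (toEuclideanLin B) := by
  conv_lhs => unfold controllableSubspace
  refine iSup_le fun i => ?_
  rintro _ ⟨w, rfl⟩
  rcases hi : (i : ℕ) with _ | k
  · exact Submodule.mem_sup_right ⟨w, by simp⟩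
  · refine Submodule.mem_sup_left ⟨toEuclideanLin (A ^ k * B) w,
      range_pow_mul_le_controllableSubspace A B k ⟨w, rfl⟩, ?_⟩
    rw [← toEuclideanLin_mul_apply, ← Matrix.mul_assoc, ← pow_succ']

/-! ### The matrix `P₂`: its transpose has kernel `S` and left-inverts it. -/

section Columns

variable {S : Submodule ℝ (E n)} (v : OrthonormalBasis (Fin l) ℝ ↥Sᗮ)

theorem columns_transpose_apply (y : E n) (j : Fin l) :
    toEuclideanLin (columns v)ᵀ y j = inner ℝ (v j : E n) y := by
  simp [toLpLin_apply, mulVec, dotProduct, columns, PiLp.inner_apply, mul_comm]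

theorem columns_transpose_eq_zero_iff (y : E n) :
    toEuclideanLin (columns v)ᵀ y = 0 ↔ y ∈ S := by
  have h1 : toEuclideanLin (columns v)ᵀ y = 0 ↔ ∀ j, inner ℝ (v j : E n) y = 0 := by
    constructor
    · intro h j
      rw [← columns_transpose_apply, h]; rfl
    · intro h
      ext j
      rw [columns_transpose_apply, h]; rfl
  rw [h1]
  constructor
  · intro h
    rw [← Submodule.orthogonal_orthogonal S, Submodule.mem_orthogonal]
    intro z hz
    have h2 := v.sum_repr ⟨z, hz⟩
    have h3 : z = ∑ i, v.repr ⟨z, hz⟩ i • (v i : E n) := by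
      have := congrArg Subtype.val h2
      simpa using this.symm
    rw [h3, sum_inner]
    refine Finset.sum_eq_zero fun i _ => ?_
    rw [inner_smul_left, h, mul_zero]
  · intro h j
    exact Submodule.inner_left_of_mem_orthogonal h (v j).2

theorem columns_transpose_mul_columns : (columns v)ᵀ * columns v = 1 := by
  ext i j
  have h := orthonormal_iff_ite.1 v.orthonormal i j
  rw [Submodule.coe_inner, PiLp.inner_apply] at h
  rw [Matrix.one_apply, ← h]
  simp [Matrix.mul_apply, columns, mul_comm]

theorem columns_transpose_columns_apply (y : E l) :
    toEuclideanLin (columns v)ᵀ (toEuclideanLin (columns v) y) = y := by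
  rw [← toEuclideanLin_mul_apply, columns_transpose_mul_columns]
  ext i
  simp

theorem sub_columns_mem (y : E n) :
    y - toEuclideanLin (columns v) (toEuclideanLin (columns v)ᵀ y) ∈ S := by
  rw [← columns_transpose_eq_zero_iff v, map_sub, columns_transpose_columns_apply, sub_self]

end Columns

/-! ### The uncontrollable block and feasibility of the static problem. -/

section Block

variable {A : Matrix (Fin n) (Fin n) ℝ} {B : Matrix (Fin n) (Fin m) ℝ}
  (v : OrthonormalBasis (Fin l) ℝ ↥(controllableSubspace A B)ᗮ)

/-- The controllable subspace is `A`-invariant and is the kernel of `P₂ᵀ`, so replacing `y` by `P₂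
P₂ᵀ y` does not change `P₂ᵀ A y`. -/
theorem columns_transpose_mul_system :
    (columns v)ᵀ * A = uncontrollableBlock A (columns v) * (columns v)ᵀ := by
  apply toEuclideanLin.injective
  ext1 y
  have h := (columns_transpose_eq_zero_iff v _).2
    (mulVec_mem_controllableSubspace A B (sub_columns_mem v y))
  rw [map_sub, map_sub, sub_eq_zero] at h
  simp only [uncontrollableBlock, toEuclideanLin_mul_apply]
  exact h

theorem columns_transpose_input_apply (w : E m) :
    toEuclideanLin (columns v)ᵀ (toEuclideanLin B w) = 0 := by
  rw [columns_transpose_eq_zero_iff]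
  exact range_le_controllableSubspace A B w

theorem columns_transpose_system_apply (y : E n) :
    toEuclideanLin (columns v)ᵀ (toEuclideanLin A y) =
      toEuclideanLin (uncontrollableBlock A (columns v)) (toEuclideanLin (columns v)ᵀ y) := by
  rw [← toEuclideanLin_mul_apply, columns_transpose_mul_system, toEuclideanLin_mul_apply]

/-- Each vector of the kernel of the uncontrollable block comes from a solution of
`A z + B u = 0`. -/
theorem exists_homogeneous_steady_pair {η : E l}
    (hη : η ∈ kernel (uncontrollableBlock A (columns v))) :
    ∃ (z : E n) (u : E m), toEuclideanLin A z + toEuclideanLin B u = 0 ∧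
      toEuclideanLin (columns v)ᵀ z = η := by
  -- Since `A₂₂ η = 0`, the vector `A P₂ η` is controllable, hence equals `A y + B w` with `y`
  -- controllable. Subtracting `y` from `P₂ η` cancels it without changing the image under `P₂ᵀ`.
  have h1 : toEuclideanLin A (toEuclideanLin (columns v) η) ∈ controllableSubspace A B := by
    rw [← columns_transpose_eq_zero_iff v, columns_transpose_system_apply,
      columns_transpose_columns_apply]
    exact hη
  obtain ⟨_, ⟨y, hy, rfl⟩, _, ⟨w, rfl⟩, h2⟩ := Submodule.mem_sup.1 (controllableSubspace_le A B h1)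
  refine ⟨toEuclideanLin (columns v) η - y, -w, ?_, ?_⟩
  · rw [map_sub, map_neg, ← h2]
    abel
  · rw [map_sub, columns_transpose_columns_apply, (columns_transpose_eq_zero_iff v y).2 hy, sub_zero]

theorem sub_kernelProj_mem {M : Matrix (Fin l) (Fin l) ℝ} {y : E l}
    (hy : y ∈ stableSubspace M ⊔ kernel M) : y - kernelProj M ⟨y, hy⟩ ∈ stableSubspace M :=
  Submodule.sub_projection_mem (isCompl_kernel_stableSubspace M) ⟨y, hy⟩

theorem kernelProj_mem {M : Matrix (Fin l) (Fin l) ℝ} {y : E l}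
    (hy : y ∈ stableSubspace M ⊔ kernel M) : kernelProj M ⟨y, hy⟩ ∈ kernel M :=
  Submodule.projection_apply_mem (isCompl_kernel_stableSubspace M) ⟨y, hy⟩

/-- Writing `b = A z₀ + B w₀` makes `(-z₀, -w₀)` satisfy the steady equation. Its error in the
second constraint lies in `ker A₂₂`, because `A₂₂ c = P₂ᵀ b = A₂₂ P₂ᵀ z₀`, and a homogeneous steady
pair corrects it. -/
theorem steadyPairs_nonempty {b : E n}
    (hb : ∃ (z : E n) (w : E m), b = toEuclideanLin A z + toEuclideanLin B w) {c : E l}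
    (hc : toEuclideanLin (uncontrollableBlock A (columns v)) c = toEuclideanLin (columns v)ᵀ b)
    {x : E n} (hx : x ∈ feasibleStates A (columns v) c) :
    (steadyPairs A B b (columns v) c x hx).Nonempty := by
  obtain ⟨z₀, w₀, hb⟩ := hb
  have h1 : c - toEuclideanLin (columns v)ᵀ z₀ ∈ kernel (uncontrollableBlock A (columns v)) := by
    rw [kernel, LinearMap.mem_ker, map_sub, hc, hb, map_add, columns_transpose_input_apply,
      columns_transpose_system_apply, add_zero, sub_self]
  obtain ⟨z, u, h2, h3⟩ := exists_homogeneous_steady_pair v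
    (sub_mem (kernelProj_mem hx) h1)
  refine ⟨(z - z₀, u - w₀), ?_, ?_⟩
  · simp only [map_sub]
    rw [hb, ← h2]
    abel
  · simp only [map_sub]
    rw [h3]
    abel

end Block

/-! ### Exponentially decaying functions and scalar linear equations. -/

/-- Exponential decay of a function on `[0, ∞)`. -/
def ExpDecay {F : Type*} [Norm F] (g : ℝ → F) : Prop :=
  ∃ C α : ℝ, 0 < α ∧ ∀ t, 0 ≤ t → ‖g t‖ ≤ C * Real.exp (-α * t)

namespace ExpDecay

section
variable {F : Type*} [SeminormedAddCommGroup F] {g h : ℝ → F}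

theorem exists_nonneg (hg : ExpDecay g) : ∃ C α : ℝ, 0 ≤ C ∧ 0 < α ∧
    ∀ t, 0 ≤ t → ‖g t‖ ≤ C * Real.exp (-α * t) := by
  obtain ⟨C, α, hα, h⟩ := hg
  refine ⟨C, α, ?_, hα, h⟩
  have := (norm_nonneg _).trans (h 0 le_rfl)
  simpa using this

theorem of_norm_le {G : Type*} [SeminormedAddCommGroup G] {k : ℝ → G} (hg : ExpDecay g) (L : ℝ)
    (hL : 0 ≤ L) (hk : ∀ t, ‖k t‖ ≤ L * ‖g t‖) : ExpDecay k := by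
  obtain ⟨C, α, hα, h⟩ := hg
  refine ⟨L * C, α, hα, fun t ht => (hk t).trans ?_⟩
  rw [mul_assoc]
  exact mul_le_mul_of_nonneg_left (h t ht) hL

theorem add (hg : ExpDecay g) (hh : ExpDecay h) : ExpDecay (fun t => g t + h t) := by
  obtain ⟨C, α, hC, hα, hg⟩ := hg.exists_nonneg
  obtain ⟨C', α', hC', hα', hh⟩ := hh.exists_nonneg
  refine ⟨C + C', min α α', lt_min hα hα', fun t ht => (norm_add_le _ _).trans ?_⟩
  rw [add_mul]
  refine add_le_add ((hg t ht).trans ?_) ((hh t ht).trans ?_)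
  · gcongr
    exact min_le_left _ _
  · gcongr
    exact min_le_right _ _

theorem zero : ExpDecay (fun _ => (0 : F)) := ⟨0, 1, one_pos, by simp⟩

theorem neg (hg : ExpDecay g) : ExpDecay (fun t => -g t) :=
  hg.of_norm_le 1 zero_le_one (by simp)

/-- The integrals over `[0, T]` of the norm are bounded uniformly in `T`. -/
theorem exists_integral_le (hg : ExpDecay g) (hc : Continuous g) :
    ∃ K : ℝ, 0 ≤ K ∧ ∀ T, 0 ≤ T → ∫ t in 0..T, ‖g t‖ ≤ K := by
  obtain ⟨C, α, hC, hα, h⟩ := hg.exists_nonneg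
  refine ⟨C / α, by positivity, fun T hT => ?_⟩
  calc ∫ t in 0..T, ‖g t‖ ≤ ∫ t in 0..T, C * Real.exp (-α * t) := by
        apply intervalIntegral.integral_mono_on hT
        · exact hc.norm.intervalIntegrable _ _
        · exact Continuous.intervalIntegrable (by fun_prop) _ _
        · exact fun t ht => h t ht.1
    _ = C / α * (1 - Real.exp (-α * T)) := by
        rw [intervalIntegral.integral_eq_sub_of_hasDerivAt
          (f := fun t => -(C / α) * Real.exp (-α * t))]
        · simp; ring
        · intro t _
          have h1 : HasDerivAt (fun t : ℝ => -α * t) (-α) t := by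
            simpa using (hasDerivAt_id t).const_mul (-α)
          refine HasDerivAt.congr_deriv (h1.exp.const_mul (-(C / α))) ?_
          field_simp [hα.ne']
        · exact Continuous.intervalIntegrable (by fun_prop) _ _
    _ ≤ C / α := by
        have := Real.exp_pos (-α * T)
        have : 0 ≤ C / α := by positivity
        nlinarith

end

variable {F : Type*} [NormedAddCommGroup F] [NormedSpace ℂ F] [CompleteSpace F] {g : ℝ → F}

/-- The equation `h' = μ h + g` with `Re μ < 0` and `g` exponentially decaying has exponentially
decaying solutions only. -/
theorem exists_solution (hg : ExpDecay g) (hc : Continuous g) {μ : ℂ} (hμ : μ.re < 0) (h₀ : F) :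
    ∃ h : ℝ → F, h 0 = h₀ ∧ (∀ t, HasDerivAt h (μ • h t + g t) t) ∧ ExpDecay h := by
  have hexp : ∀ (ν : ℂ) (t : ℝ), HasDerivAt (fun t : ℝ => Complex.exp (ν * t))
      (Complex.exp (ν * t) * ν) t := by
    intro ν t
    have h1 : HasDerivAt (fun t : ℝ => ν * (t : ℂ)) ν t := by
      simpa using (Complex.ofRealCLM.hasDerivAt (x := t)).const_mul ν
    exact h1.cexp
  have hcont : Continuous fun τ : ℝ => Complex.exp (-μ * τ) • g τ := by fun_prop
  refine ⟨fun t => Complex.exp (μ * t) • (h₀ + ∫ τ in 0..t, Complex.exp (-μ * τ) • g τ),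
    by simp, fun t => ?_, ?_⟩
  · have h2 := (hcont.integral_hasStrictDerivAt 0 t).hasDerivAt.const_add h₀
    refine HasDerivAt.congr_deriv ((hexp μ t).smul h2) ?_
    rw [smul_smul, ← Complex.exp_add, add_comm (_ • _), mul_comm (Complex.exp _) μ, smul_smul]
    simp
  · obtain ⟨C, α, hC, hα, h⟩ := hg.exists_nonneg
    -- The rates `α` and `-Re μ` may coincide, so the variation-of-constants integral is only
    -- bounded by `t` times an exponential. Half of the smaller rate is given up to absorb the
    -- factor `t`.
    set γ := min α (-μ.re) with hγ
    have hγ0 : 0 < γ := lt_min hα (by linarith)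
    have hb : ∀ t, 0 ≤ t →
        ‖∫ τ in 0..t, Complex.exp (-μ * τ) • g τ‖ ≤ C * t * Real.exp ((-μ.re - γ) * t) := by
      intro t ht
      have := intervalIntegral.norm_integral_le_of_norm_le_const
        (f := fun τ : ℝ => Complex.exp (-μ * τ) • g τ) (a := 0) (b := t)
        (C := C * Real.exp ((-μ.re - γ) * t)) ?_
      · rw [sub_zero, abs_of_nonneg ht] at this
        linarith
      · intro τ hτ
        rw [uIoc_of_le ht] at hτ
        rw [norm_smul, Complex.norm_exp]
        have h1 : (-μ * (τ : ℂ)).re = -μ.re * τ := by simp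
        rw [h1]
        calc Real.exp (-μ.re * τ) * ‖g τ‖ ≤ Real.exp (-μ.re * τ) * (C * Real.exp (-α * τ)) := by
              gcongr
              exact h τ hτ.1.le
          _ = C * Real.exp ((-μ.re - α) * τ) := by
              rw [mul_left_comm, ← Real.exp_add]
              congr 2
              ring
          _ ≤ C * Real.exp ((-μ.re - γ) * t) := by
              gcongr 2
              have h2 : γ ≤ α := min_le_left _ _
              have h3 : γ ≤ -μ.re := min_le_right _ _
              calc (-μ.re - α) * τ ≤ (-μ.re - γ) * τ := by
                    apply mul_le_mul_of_nonneg_right _ hτ.1.le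
                    linarith
                _ ≤ (-μ.re - γ) * t := by
                    apply mul_le_mul_of_nonneg_left hτ.2
                    linarith
    refine ⟨‖h₀‖ + C * (2 / γ), γ / 2, by positivity, fun t ht => ?_⟩
    rw [norm_smul, Complex.norm_exp]
    have h1 : (μ * (t : ℂ)).re = μ.re * t := by simp
    rw [h1]
    have h3 : γ ≤ -μ.re := min_le_right _ _
    have h4 : t ≤ 2 / γ * Real.exp (γ / 2 * t) := by
      have := Real.add_one_le_exp (γ / 2 * t)
      rw [div_mul_eq_mul_div, le_div_iff₀ hγ0]
      nlinarith
    calc Real.exp (μ.re * t) * ‖h₀ + ∫ τ in 0..t, Complex.exp (-μ * τ) • g τ‖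
        ≤ Real.exp (μ.re * t) * (‖h₀‖ + C * t * Real.exp ((-μ.re - γ) * t)) := by
          gcongr
          exact (norm_add_le _ _).trans (by gcongr; exact hb t ht)
      _ = ‖h₀‖ * Real.exp (μ.re * t) + C * t * Real.exp (-γ * t) := by
          have : Real.exp (-γ * t) = Real.exp (μ.re * t) * Real.exp ((-μ.re - γ) * t) := by
            rw [← Real.exp_add]; congr 1; ring
          rw [this]; ring
      _ ≤ ‖h₀‖ * Real.exp (-(γ / 2) * t) +
            C * (2 / γ * Real.exp (γ / 2 * t)) * Real.exp (-γ * t) := by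
          gcongr
          linarith
      _ = (‖h₀‖ + C * (2 / γ)) * Real.exp (-(γ / 2) * t) := by
          have : Real.exp (-(γ / 2) * t) = Real.exp (γ / 2 * t) * Real.exp (-γ * t) := by
            rw [← Real.exp_add]; congr 1; ring
          rw [this]; ring

end ExpDecay

/-! ### States that can be steered to zero exponentially fast. -/

section Decaying

variable {F G : Type*} [NormedAddCommGroup F] [NormedSpace ℂ F]
  [NormedAddCommGroup G] [NormedSpace ℂ G]

/-- The states from which the system `ξ' = A ξ + B w` can be steered to zero exponentially fast by
an exponentially decaying control. -/
def decayingStates (A : F →L[ℂ] F) (B : G →L[ℂ] F) : Submodule ℂ F where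
  carrier := {s | ∃ (ξ : ℝ → F) (w : ℝ → G), Continuous w ∧ ξ 0 = s ∧
    (∀ t, HasDerivAt ξ (A (ξ t) + B (w t)) t) ∧ ExpDecay ξ ∧ ExpDecay w}
  add_mem' := by
    rintro _ _ ⟨ξ, w, hw, rfl, h, h1, h2⟩ ⟨ξ', w', hw', rfl, h', h1', h2'⟩
    refine ⟨fun t => ξ t + ξ' t, fun t => w t + w' t, hw.add hw', rfl, fun t => ?_, h1.add h1',
      h2.add h2'⟩
    refine HasDerivAt.congr_deriv ((h t).add (h' t)) ?_
    simp only [map_add]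
    abel
  zero_mem' := ⟨fun _ => 0, fun _ => 0, continuous_const, rfl, fun t => by
    simpa using hasDerivAt_const t (0 : F), ExpDecay.zero, ExpDecay.zero⟩
  smul_mem' := by
    rintro r _ ⟨ξ, w, hw, rfl, h, h1, h2⟩
    refine ⟨fun t => r • ξ t, fun t => r • w t, hw.const_smul r, rfl, fun t => ?_,
      h1.of_norm_le ‖r‖ (norm_nonneg _) (fun t => (norm_smul _ _).le),
      h2.of_norm_le ‖r‖ (norm_nonneg _) (fun t => (norm_smul _ _).le)⟩
    refine HasDerivAt.congr_deriv ((h t).const_smul r) ?_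
    simp only [map_smul, smul_add]

variable [CompleteSpace F] [CompleteSpace G] {A : F →L[ℂ] F} {B : G →L[ℂ] F}

/-- Let `(ξ', w')` be a decaying pair from `A s - μ s - B w₀`. Solve `dξ/dt = μ ξ + ξ'` from `s` and
`dω/dt = μ ω - w'` from `w₀`; both solutions decay. The defect `η = A ξ - μ ξ - ξ' - B ω` satisfies
`dη/dt = μ η` and starts at zero, so it vanishes: `ξ` is the trajectory for the control `-ω`. -/
theorem mem_decayingStates_of_sub {μ : ℂ} (hμ : μ.re < 0) {s : F} (w₀ : G)
    (hs : A s - μ • s - B w₀ ∈ decayingStates A B) : s ∈ decayingStates A B := by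
  obtain ⟨ξ', w', hw', h0, hd, h1, h2⟩ := hs
  have hξ' : Continuous ξ' := continuous_iff_continuousAt.2 fun t => (hd t).continuousAt
  obtain ⟨ξ, hξ0, hξ, hξd⟩ := h1.exists_solution hξ' hμ s
  obtain ⟨ω, hω0, hω, hωd⟩ := h2.neg.exists_solution hw'.neg hμ w₀
  have hωc : Continuous ω := continuous_iff_continuousAt.2 fun t => (hω t).continuousAt
  have hη : ∀ t, A (ξ t) - μ • ξ t - ξ' t - B (ω t) = 0 := by
    set η := fun t => A (ξ t) - μ • ξ t - ξ' t - B (ω t) with hη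
    have hη' : ∀ t, HasDerivAt η (μ • η t) t := by
      intro t
      have e1 : HasDerivAt (fun t => A (ξ t)) (A (μ • ξ t + ξ' t)) t :=
        (A.restrictScalars ℝ).hasFDerivAt.comp_hasDerivAt t (hξ t)
      have e2 : HasDerivAt (fun t => B (ω t)) (B (μ • ω t + -w' t)) t :=
        (B.restrictScalars ℝ).hasFDerivAt.comp_hasDerivAt t (hω t)
      refine HasDerivAt.congr_deriv (((e1.sub ((hξ t).const_smul μ)).sub (hd t)).sub e2) ?_
      simp only [hη, map_add, map_smul, map_neg, smul_sub, smul_add]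
      abel
    have hexp : ∀ t : ℝ, HasDerivAt (fun t : ℝ => Complex.exp (-μ * t))
        (Complex.exp (-μ * t) * -μ) t := by
      intro t
      have h1 : HasDerivAt (fun t : ℝ => -μ * (t : ℂ)) (-μ) t := by
        simpa using (Complex.ofRealCLM.hasDerivAt (x := t)).const_mul (-μ)
      exact h1.cexp
    have hconst : ∀ t, HasDerivAt (fun t : ℝ => Complex.exp (-μ * t) • η t) 0 t := by
      intro t
      refine HasDerivAt.congr_deriv ((hexp t).smul (hη' t)) ?_
      rw [smul_smul, ← add_smul]
      simp
    intro t
    have h3 := is_const_of_deriv_eq_zero (fun t => (hconst t).differentiableAt)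
      (fun t => (hconst t).deriv) t 0
    have h4 : η 0 = 0 := by simp [hη, hξ0, hω0, h0]
    simp only [h4, smul_zero] at h3
    exact (smul_eq_zero.1 h3).resolve_left (Complex.exp_ne_zero _)
  refine ⟨ξ, fun t => -ω t, hωc.neg, hξ0, fun t => ?_, hξd, hωd.neg⟩
  refine (hξ t).congr_deriv ?_
  rw [map_neg, eq_comm, ← sub_eq_zero, ← hη t]
  abel

/-- With `R μ = (1 - μ A)⁻¹` and `μ` negative and near `0`, the states `A ^ k (R μ (B w))` are
decaying. They tend to `A ^ k (B w)` as `μ → 0`, and a finite-dimensional subspace is closed. Each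
limit feeds the induction for the next power. -/
theorem pow_apply_mem_decayingStates [FiniteDimensional ℂ F] (k : ℕ) (w : G) :
    (A ^ k) (B w) ∈ decayingStates A B := by
  set R : ℝ → F →L[ℂ] F := fun μ => Ring.inverse (1 - (μ : ℂ) • A) with hR
  have hlim : Filter.Tendsto R (nhdsWithin 0 (Iio 0)) (nhds 1) := by
    have h1 : Filter.Tendsto (fun μ : ℝ => (1 : F →L[ℂ] F) - (μ : ℂ) • A) (nhds 0) (nhds 1) := by
      have : Continuous (fun μ : ℝ => (1 : F →L[ℂ] F) - (μ : ℂ) • A) := by fun_prop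
      simpa using this.tendsto 0
    have h2 := (NormedRing.inverse_continuousAt (1 : (F →L[ℂ] F)ˣ)).tendsto
    simp only [Units.val_one, Ring.inverse_one] at h2
    exact (h2.comp h1).mono_left nhdsWithin_le_nhds
  have hinv : ∀ᶠ μ : ℝ in nhdsWithin 0 (Iio 0), (1 - (μ : ℂ) • A) * R μ = 1 := by
    have h1 : Filter.Tendsto (fun μ : ℝ => (1 : F →L[ℂ] F) - (μ : ℂ) • A) (nhds 0) (nhds 1) := by
      have : Continuous (fun μ : ℝ => (1 : F →L[ℂ] F) - (μ : ℂ) • A) := by fun_prop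
      simpa using this.tendsto 0
    have h2 := h1.eventually (Units.nhds (1 : (F →L[ℂ] F)ˣ))
    filter_upwards [nhdsWithin_le_nhds h2] with μ hμ
    exact Ring.mul_inverse_cancel _ hμ
  have hclosed : IsClosed (decayingStates A B : Set F) :=
    (decayingStates A B).closed_of_finiteDimensional
  have hstep : ∀ k : ℕ, (∀ᶠ μ : ℝ in nhdsWithin 0 (Iio 0),
      (A ^ k) (R μ (B w)) ∈ decayingStates A B) → (A ^ k) (B w) ∈ decayingStates A B := by
    intro k hk
    refine hclosed.mem_of_tendsto (f := fun μ => (A ^ k) (R μ (B w))) ?_ hk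
    have h1 : Filter.Tendsto (fun μ => R μ (B w)) (nhdsWithin 0 (Iio 0)) (nhds (B w)) := by
      exact ((ContinuousLinearMap.apply ℂ F (B w)).continuous.tendsto _).comp hlim
    exact ((A ^ k).continuous.tendsto _).comp h1
  apply hstep
  induction k with
  | zero =>
    filter_upwards [hinv, self_mem_nhdsWithin] with μ hμ hneg
    have hneg : μ < 0 := hneg
    have h1 : R μ (B w) - (μ : ℂ) • A (R μ (B w)) = B w := by
      have := congrArg (fun L : F →L[ℂ] F => L (B w)) hμ
      simpa using this
    have hμ0 : (μ : ℂ) ≠ 0 := by exact_mod_cast hneg.ne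
    -- Dividing `r - μ A r = B w` by `-μ` gives `A r - μ⁻¹ r = B (-μ⁻¹ w)`, so the remainder
    -- required to be decaying is zero.
    refine mem_decayingStates_of_sub (μ := (μ : ℂ)⁻¹) ?_ (-(μ : ℂ)⁻¹ • w) ?_
    · rw [← Complex.ofReal_inv, Complex.ofReal_re]
      exact inv_lt_zero.2 hneg
    · have h2 : A (R μ (B w)) - (μ : ℂ)⁻¹ • R μ (B w) - B (-(μ : ℂ)⁻¹ • w) = 0 := by
        generalize R μ (B w) = r at h1 ⊢
        rw [map_smul, ← h1]
        simp only [smul_sub, neg_mul, neg_smul, smul_smul, inv_mul_cancel₀ hμ0, one_smul]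
        abel
      simp only [pow_zero, one_apply_eq_self]
      rw [h2]
      exact zero_mem _
  | succ k ih =>
    have h0 := hstep k ih
    filter_upwards [hinv, self_mem_nhdsWithin, ih] with μ hμ hneg hk
    have hneg : μ < 0 := hneg
    have hμ0 : (μ : ℂ) ≠ 0 := by exact_mod_cast hneg.ne
    have h1 : R μ (B w) - (μ : ℂ) • A (R μ (B w)) = B w := by
      have := congrArg (fun L : F →L[ℂ] F => L (B w)) hμ
      simpa using this
    -- The resolvent identity `μ A R = R - 1` expresses the next power through two states already
    -- known to be decaying.
    have h2 : (A ^ (k + 1)) (R μ (B w)) = (μ : ℂ)⁻¹ • ((A ^ k) (R μ (B w)) - (A ^ k) (B w)) := by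
      generalize R μ (B w) = r at h1 ⊢
      rw [← h1]
      rw [pow_succ]
      simp only [map_sub, map_smul, sub_sub_cancel, smul_smul, inv_mul_cancel₀ hμ0, one_smul]
      rfl
    rw [h2]
    exact Submodule.smul_mem _ _ (sub_mem hk h0)

end Decaying

/-! ### Complexification and return to real trajectories. -/

/-- The complex linear map `ℂᵇ → ℂᵃ` of a real matrix. -/
def complexLin {a b : ℕ} (M : Matrix (Fin a) (Fin b) ℝ) : (Fin b → ℂ) →L[ℂ] (Fin a → ℂ) :=
  LinearMap.toContinuousLinearMap (toLin' (M.map Complex.ofReal))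

/-- The real part of a complex vector. -/
def rePart (l : ℕ) : (Fin l → ℂ) →ₗ[ℝ] E l where
  toFun y := WithLp.toLp 2 fun i => (y i).re
  map_add' y z := by ext i; simp
  map_smul' r y := by ext i; simp

/-- The imaginary part of a complex vector. -/
def imPart (l : ℕ) : (Fin l → ℂ) →ₗ[ℝ] E l where
  toFun y := WithLp.toLp 2 fun i => (y i).im
  map_add' y z := by ext i; simp
  map_smul' r y := by ext i; simp

theorem complexLin_mul_apply {a b d : ℕ} (M : Matrix (Fin a) (Fin b) ℝ)
    (N : Matrix (Fin b) (Fin d) ℝ) (y : Fin d → ℂ) :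
    complexLin (M * N) y = complexLin M (complexLin N y) := by
  have h : (M * N).map Complex.ofReal = M.map Complex.ofReal * N.map Complex.ofReal :=
    Matrix.map_mul (f := Complex.ofRealHom)
  simp [complexLin, h]

theorem complexLin_complexify {a b : ℕ} (M : Matrix (Fin a) (Fin b) ℝ) (y : E b) :
    complexLin M (complexify b y) = complexify a (toEuclideanLin M y) := by
  ext i
  simp [complexLin, complexify, toLpLin_apply, mulVec, dotProduct]

theorem rePart_complexLin {a b : ℕ} (M : Matrix (Fin a) (Fin b) ℝ) (y : Fin b → ℂ) :
    rePart a (complexLin M y) = toEuclideanLin M (rePart b y) := by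
  ext i
  simp [complexLin, rePart, toLpLin_apply, mulVec, dotProduct]

theorem imPart_complexLin {a b : ℕ} (M : Matrix (Fin a) (Fin b) ℝ) (y : Fin b → ℂ) :
    imPart a (complexLin M y) = toEuclideanLin M (imPart b y) := by
  ext i
  simp [complexLin, imPart, toLpLin_apply, mulVec, dotProduct]

theorem rePart_complexify (y : E n) : rePart n (complexify n y) = y := by
  ext i
  simp [rePart, complexify]

theorem complexify_rePart_add (s : Fin n → ℂ) :
    complexify n (rePart n s) + Complex.I • complexify n (imPart n s) = s := by
  ext i
  simp only [complexify, rePart, imPart, LinearMap.coe_mk, AddHom.coe_mk, Pi.add_apply,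
    Pi.smul_apply, smul_eq_mul]
  rw [mul_comm]
  exact Complex.re_add_im (s i)

theorem ExpDecay.rePart {g : ℝ → Fin l → ℂ} (hg : ExpDecay g) :
    ExpDecay fun t => rePart l (g t) := by
  set R : (Fin l → ℂ) →L[ℝ] E l := LinearMap.toContinuousLinearMap (Turnpike.rePart l)
  exact hg.of_norm_le ‖R‖ (norm_nonneg _) fun t => R.le_opNorm _

section

variable {A : Matrix (Fin n) (Fin n) ℝ} {B : Matrix (Fin n) (Fin m) ℝ}
  (v : OrthonormalBasis (Fin l) ℝ ↥(controllableSubspace A B)ᗮ)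

theorem complexify_mem_decayingStates {y : E n} (hy : y ∈ controllableSubspace A B) :
    complexify n y ∈ decayingStates (complexLin A) (complexLin B) := by
  suffices h : controllableSubspace A B ≤ ((decayingStates (complexLin A)
      (complexLin B)).restrictScalars ℝ).comap (complexify n) from h hy
  refine iSup_le fun i => ?_
  rintro _ ⟨w, rfl⟩
  have h : ∀ (k : ℕ) (z : E n),
      complexify n (toEuclideanLin (A ^ k) z) = (complexLin A ^ k) (complexify n z) := by
    intro k
    induction k with
    | zero => intro z; simp
    | succ k ih =>
      intro z
      rw [pow_succ, toEuclideanLin_mul_apply, ih, pow_succ, ← complexLin_complexify]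
      rfl
  rw [Submodule.mem_comap, toEuclideanLin_mul_apply, h, ← complexLin_complexify]
  exact pow_apply_mem_decayingStates _ _

/-- The matrices are real, so the real and imaginary parts of `s` are both controllable. -/
theorem mem_decayingStates_of_columns_eq_zero {s : Fin n → ℂ}
    (hs : complexLin (columns v)ᵀ s = 0) :
    s ∈ decayingStates (complexLin A) (complexLin B) := by
  rw [← complexify_rePart_add s]
  refine add_mem (complexify_mem_decayingStates ?_)
    (Submodule.smul_mem _ _ (complexify_mem_decayingStates ?_))
  · rw [← columns_transpose_eq_zero_iff v, ← rePart_complexLin, hs, map_zero]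
  · rw [← columns_transpose_eq_zero_iff v, ← imPart_complexLin, hs, map_zero]

/-- Descent along a Jordan chain: `P₂ᵀ` intertwines `A` with `A₂₂`, so passing from `s` to `A s - μ
s` lowers the exponent by one. The chain ends in the kernel of `P₂ᵀ`. -/
theorem mem_decayingStates_of_pow {μ : ℂ} (hμ : μ.re < 0) (k : ℕ) {s : Fin n → ℂ}
    (hs : ((toLin' ((uncontrollableBlock A (columns v)).map Complex.ofReal) -
      μ • (1 : Module.End ℂ (Fin l → ℂ))) ^ k) (complexLin (columns v)ᵀ s) = 0) :
    s ∈ decayingStates (complexLin A) (complexLin B) := by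
  induction k generalizing s with
  | zero => exact mem_decayingStates_of_columns_eq_zero v hs
  | succ k ih =>
    refine mem_decayingStates_of_sub hμ 0 ?_
    rw [map_zero, sub_zero]
    apply ih
    rw [pow_succ] at hs
    rw [map_sub, map_smul, ← complexLin_mul_apply, columns_transpose_mul_system,
      complexLin_mul_apply]
    exact hs

/-- Each stable generalized eigenvector lifts through `P₂` to a decaying state. A lift is unique up
to the kernel of `P₂ᵀ`, which consists of decaying states. -/
theorem mem_decayingStates_of_stable {y : E n} (hy : toEuclideanLin (columns v)ᵀ y ∈
    stableSubspace (uncontrollableBlock A (columns v))) :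
    complexify n y ∈ decayingStates (complexLin A) (complexLin B) := by
  set D := decayingStates (complexLin A) (complexLin B) with hD
  have h1 : (⨆ μ ∈ spectrum ℂ ((uncontrollableBlock A (columns v)).map Complex.ofReal) ∩
      {μ : ℂ | μ.re < 0}, Module.End.maxGenEigenspace
        (toLin' ((uncontrollableBlock A (columns v)).map Complex.ofReal)) μ) ≤
      D.map (complexLin (columns v)ᵀ : (Fin n → ℂ) →ₗ[ℂ] (Fin l → ℂ)) := by
    refine iSup₂_le fun μ hμ z hz => ?_
    obtain ⟨k, hk⟩ := Module.End.mem_maxGenEigenspace _ _ _ |>.1 hz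
    have h2 : complexLin (columns v)ᵀ (complexLin (columns v) z) = z := by
      rw [← complexLin_mul_apply, columns_transpose_mul_columns]
      simp [complexLin]
    refine ⟨complexLin (columns v) z, mem_decayingStates_of_pow v hμ.2 k ?_, h2⟩
    rw [h2]
    exact hk
  obtain ⟨s, hs, hsy⟩ := h1 hy
  have h3 : complexify n y - s ∈ D := by
    apply mem_decayingStates_of_columns_eq_zero v
    rw [map_sub, complexLin_complexify, sub_eq_zero]
    exact hsy.symm
  simpa using add_mem h3 hs

/-- An initial state whose uncontrollable component is stable can be steered to zero exponentially
fast. -/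
theorem exists_decaying_trajectory {y : E n} (hy : toEuclideanLin (columns v)ᵀ y ∈
    stableSubspace (uncontrollableBlock A (columns v))) :
    ∃ (ξ : ℝ → E n) (w : ℝ → E m), Continuous w ∧ ξ 0 = y ∧
      (∀ t, HasDerivAt ξ (toEuclideanLin A (ξ t) + toEuclideanLin B (w t)) t) ∧
      ExpDecay ξ ∧ ExpDecay w := by
  obtain ⟨ξ, w, hw, h0, hξ, h1, h2⟩ := mem_decayingStates_of_stable v hy
  have hR : ∀ l, Continuous (rePart l) := fun l => (rePart l).continuous_of_finiteDimensional
  refine ⟨fun t => rePart n (ξ t), fun t => rePart m (w t), (hR m).comp hw,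
    by simp only [h0, rePart_complexify], fun t => ?_, h1.rePart, h2.rePart⟩
  have h3 := (LinearMap.toContinuousLinearMap (rePart n)).hasFDerivAt.comp_hasDerivAt t (hξ t)
  refine h3.congr_deriv ?_
  change rePart n (complexLin A (ξ t) + complexLin B (w t)) = _
  rw [map_add, rePart_complexLin, rePart_complexLin]

end

/-! ### Strong convexity, minimizers and multipliers. -/

/-- A `C²` function on `[0, 1]` with second derivative at least `r` grows quadratically. -/
theorem le_of_second_deriv_ge {g g' g'' : ℝ → ℝ} {r : ℝ} (hg : ∀ t, HasDerivAt g (g' t) t)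
    (hg' : ∀ t, HasDerivAt g' (g'' t) t) (hr : ∀ t, r ≤ g'' t) :
    g 0 + g' 0 + r / 2 ≤ g 1 := by
  have h1 : ∀ t, 0 ≤ t → g' 0 + r * t ≤ g' t := by
    intro t ht
    have hm : Monotone fun t => g' t - r * t := by
      apply monotone_of_hasDerivAt_nonneg (f' := fun t => g'' t - r)
      · intro t
        exact ((hg' t).sub ((hasDerivAt_id t).const_mul r)).congr_deriv (by simp)
      · intro t
        simpa using hr t
    have := hm ht
    simp only [mul_zero, sub_zero] at this
    linarith
  have hm : MonotoneOn (fun t => g t - g' 0 * t - r * t ^ 2 / 2) (Icc 0 1) := by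
    have hd : ∀ t, HasDerivAt (fun t => g t - g' 0 * t - r * t ^ 2 / 2) (g' t - g' 0 - r * t) t := by
      intro t
      refine HasDerivAt.congr_deriv (((hg t).sub ((hasDerivAt_id t).const_mul (g' 0))).sub
        (((hasDerivAt_pow 2 t).const_mul r).div_const 2)) ?_
      simp
      ring
    apply monotoneOn_of_deriv_nonneg (convex_Icc 0 1)
    · exact fun t _ => (hd t).continuousAt.continuousWithinAt
    · exact fun t _ => (hd t).differentiableAt.differentiableWithinAt
    · intro t ht
      rw [interior_Icc] at ht
      rw [(hd t).deriv]
      linarith [h1 t ht.1.le]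
  have := hm (left_mem_Icc.2 zero_le_one) (right_mem_Icc.2 zero_le_one) zero_le_one
  simp only [mul_zero, sub_zero, mul_one, one_pow] at this
  norm_num at this
  linarith

section StronglyConvex

variable {f : E n × E m → ℝ}

theorem le_of_hessian_ge (hf : ContDiff ℝ 2 f) {δ : ℝ}
    (hδ : ∀ p w : E n × E m, δ * (‖w.1‖ ^ 2 + ‖w.2‖ ^ 2) ≤ fderiv ℝ (fderiv ℝ f) p w w)
    (p w : E n × E m) :
    f p + fderiv ℝ f p w + δ / 2 * (‖w.1‖ ^ 2 + ‖w.2‖ ^ 2) ≤ f (p + w) := by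
  have hline : ∀ t : ℝ, HasDerivAt (fun t : ℝ => p + t • w) w t := by
    intro t
    simpa using ((hasDerivAt_id t).smul_const w).const_add p
  have hf1 : Differentiable ℝ f := hf.differentiable (by norm_num)
  have hf2 : Differentiable ℝ (fderiv ℝ f) :=
    (hf.fderiv_right (m := 1) (by norm_num)).differentiable (by norm_num)
  have h := le_of_second_deriv_ge (g := fun t => f (p + t • w))
    (g' := fun t => fderiv ℝ f (p + t • w) w)
    (g'' := fun t => fderiv ℝ (fderiv ℝ f) (p + t • w) w w)
    (r := δ * (‖w.1‖ ^ 2 + ‖w.2‖ ^ 2)) ?_ ?_ ?_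
  · simp only [zero_smul, add_zero, one_smul] at h
    linarith
  · exact fun t => (hf1 _).hasFDerivAt.comp_hasDerivAt t (hline t)
  · intro t
    have h1 := (hf2 (p + t • w)).hasFDerivAt.comp_hasDerivAt t (hline t)
    simpa using h1.clm_apply (hasDerivAt_const t w)
  · exact fun t => hδ _ _

/-- The quadratic lower bound at one point of `S` makes `f` coercive, and the space is
finite-dimensional. -/
theorem exists_isMinOn_of_isStronglyConvexC2 (hf : IsStronglyConvexC2 f) {S : Set (E n × E m)}
    (hS : IsClosed S) (hne : S.Nonempty) : ∃ p ∈ S, IsMinOn f S p := by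
  obtain ⟨hf, δ, hδ0, hδ⟩ := hf
  obtain ⟨p₀, hp₀⟩ := hne
  have hlow : ∀ p, f p₀ + (δ / 2 * ‖p - p₀‖ - ‖fderiv ℝ f p₀‖) * ‖p - p₀‖ ≤ f p := by
    intro p
    have h1 := le_of_hessian_ge hf hδ p₀ (p - p₀)
    rw [add_sub_cancel] at h1
    have h2 := neg_le_of_abs_le ((fderiv ℝ f p₀).le_opNorm (p - p₀))
    -- The product carries the maximum norm, while the Hessian bound is in terms of the sum of
    -- squares.
    have h3 : ‖p - p₀‖ ^ 2 ≤ ‖(p - p₀).1‖ ^ 2 + ‖(p - p₀).2‖ ^ 2 := by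
      rw [Prod.norm_def]
      rcases max_choice ‖(p - p₀).1‖ ‖(p - p₀).2‖ with h | h <;> rw [h] <;>
        nlinarith [sq_nonneg ‖(p - p₀).1‖, sq_nonneg ‖(p - p₀).2‖]
    nlinarith
  refine hf.continuous.continuousOn.exists_isMinOn' hS hp₀ ?_
  rw [Filter.eventually_inf_principal]
  have h1 : Filter.Tendsto (fun p : E n × E m => ‖p - p₀‖) (Filter.cocompact _) Filter.atTop := by
    have := tendsto_norm_cocompact_atTop (E := E n × E m)
    have h2 := Filter.tendsto_atTop_add_const_right _ (-‖p₀‖) this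
    refine Filter.tendsto_atTop_mono (fun p => ?_) h2
    have := norm_sub_norm_le p p₀
    linarith
  filter_upwards [h1.eventually_ge_atTop (2 * ‖fderiv ℝ f p₀‖ / δ)] with p hp _
  refine le_trans ?_ (hlow p)
  rw [div_le_iff₀ hδ0] at hp
  have : 0 ≤ (δ / 2 * ‖p - p₀‖ - ‖fderiv ℝ f p₀‖) * ‖p - p₀‖ :=
    mul_nonneg (by linarith) (norm_nonneg _)
  linarith

end StronglyConvex

/-- A linear form that vanishes on the kernel of a linear map factors through it. -/
theorem exists_comp_eq_of_ker_le {V W : Type*} [AddCommGroup V] [Module ℝ V] [AddCommGroup W]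
    [Module ℝ W] (L : V →ₗ[ℝ] W) (φ : V →ₗ[ℝ] ℝ) (h : LinearMap.ker L ≤ LinearMap.ker φ) :
    ∃ ψ : W →ₗ[ℝ] ℝ, ψ ∘ₗ L = φ := by
  have h1 : φ ∈ (LinearMap.ker L).dualAnnihilator := by
    rw [Submodule.mem_dualAnnihilator]
    exact fun w hw => h hw
  rw [← LinearMap.range_dualMap_eq_dualAnnihilator_ker] at h1
  obtain ⟨ψ, hψ⟩ := h1
  exact ⟨ψ, hψ⟩

/-- The first-order conditions at a minimizer over the steady pairs. -/
theorem exists_multipliers {A : Matrix (Fin n) (Fin n) ℝ} {B : Matrix (Fin n) (Fin m) ℝ} {b : E n}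
    {f : E n × E m → ℝ} {P₂ : Matrix (Fin n) (Fin l) ℝ} {c : E l} {x : E n}
    {hx : x ∈ feasibleStates A P₂ c} (hf : Differentiable ℝ f) {p : E n × E m}
    (hp : p ∈ steadyPairs A B b P₂ c x hx) (hmin : IsMinOn f (steadyPairs A B b P₂ c x hx) p) :
    ∃ (ψ₁ : E n →L[ℝ] ℝ) (ψ₂ : E l →L[ℝ] ℝ), ∀ z w, fderiv ℝ f p (z, w) =
      ψ₁ (toEuclideanLin A z + toEuclideanLin B w) + ψ₂ (toEuclideanLin P₂ᵀ z) := by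
  set L : E n × E m →ₗ[ℝ] E n × E l :=
    ((toEuclideanLin A).coprod (toEuclideanLin B)).prod
      ((toEuclideanLin P₂ᵀ) ∘ₗ LinearMap.fst ℝ (E n) (E m)) with hL
  have hLa : ∀ z w, L (z, w) = (toEuclideanLin A z + toEuclideanLin B w, toEuclideanLin P₂ᵀ z) :=
    fun z w => rfl
  obtain ⟨ψ, hψ⟩ := exists_comp_eq_of_ker_le L (fderiv ℝ f p : E n × E m →ₗ[ℝ] ℝ) (by
    rintro ⟨z, w⟩ hw
    rw [LinearMap.mem_ker, hLa, Prod.mk_eq_zero] at hw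
    -- A direction in the kernel of the constraint map keeps `p + t • (z, w)` feasible for `t` of
    -- either sign, so the derivative of `f` along it vanishes.
    have hline : HasDerivAt (fun t : ℝ => p + t • (z, w)) (z, w) 0 := by
      simpa using ((hasDerivAt_id (0 : ℝ)).smul_const (z, w)).const_add p
    have hd : HasDerivAt (fun t : ℝ => f (p + t • (z, w))) (fderiv ℝ f p (z, w)) 0 := by
      have h1 := (hf (p + (0 : ℝ) • (z, w))).hasFDerivAt.comp_hasDerivAt 0 hline
      exact h1.congr_deriv (by simp)
    have hloc : IsLocalMin (fun t : ℝ => f (p + t • (z, w))) 0 := by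
      refine Filter.Eventually.of_forall fun t => ?_
      simp only [zero_smul, add_zero]
      apply hmin
      refine ⟨?_, ?_⟩
      · have e : toEuclideanLin A (p + t • (z, w)).1 + toEuclideanLin B (p + t • (z, w)).2 + b =
            (toEuclideanLin A p.1 + toEuclideanLin B p.2 + b) +
              t • (toEuclideanLin A z + toEuclideanLin B w) := by
          simp only [Prod.fst_add, Prod.smul_fst, Prod.snd_add, Prod.smul_snd, map_add, map_smul,
            smul_add]
          abel
        rw [e, hp.1, hw.1, smul_zero, add_zero]
      · have e : toEuclideanLin P₂ᵀ (p + t • (z, w)).1 + c =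
            (toEuclideanLin P₂ᵀ p.1 + c) + t • toEuclideanLin P₂ᵀ z := by
          simp only [Prod.fst_add, Prod.smul_fst, map_add, map_smul]
          abel
        rw [e, hp.2, hw.2, smul_zero, add_zero]
    exact hloc.hasDerivAt_eq_zero hd)
  refine ⟨LinearMap.toContinuousLinearMap (ψ ∘ₗ LinearMap.inl ℝ _ _),
    LinearMap.toContinuousLinearMap (ψ ∘ₗ LinearMap.inr ℝ _ _), fun z w => ?_⟩
  have h1 := LinearMap.congr_fun hψ (z, w)
  rw [LinearMap.comp_apply, hLa] at h1
  change _ = fderiv ℝ f p (z, w) at h1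
  rw [← h1]
  simp only [LinearMap.coe_toContinuousLinearMap', LinearMap.comp_apply, LinearMap.inl_apply,
    LinearMap.inr_apply, ← map_add, Prod.mk_add_mk, add_zero, zero_add]

/-! ### Endpoint estimate and properties of trajectories. -/

/-- A bound for the endpoint of a curve by the integral of a function that dominates the distance
to a point and the speed, uniformly in the length of the interval. -/
theorem norm_endpoint_sub_le {N : Type*} [NormedAddCommGroup N] [NormedSpace ℝ N]
    {X g : ℝ → N} {e : ℝ → ℝ} {z : N} {T C : ℝ} (hT : 0 < T) (hC : 0 ≤ C)
    (he : IntervalIntegrable e volume 0 T) (he0 : ∀ t, 0 ≤ e t)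
    (hg : IntervalIntegrable g volume 0 T)
    (hX : ∀ t ∈ Icc 0 T, X t = X 0 + ∫ s in 0..t, g s)
    (h1 : ∀ t, ‖X t - z‖ ≤ e t + C) (h2 : ∀ t, ‖g t‖ ≤ e t + C) :
    ‖X T - z‖ ≤ 2 * (∫ t in 0..T, e t) + 2 * C + ‖X 0 - z‖ := by
  have hE : 0 ≤ ∫ t in 0..T, e t := intervalIntegral.integral_nonneg hT.le fun t _ => he0 t
  have hsub : ∀ s ∈ Icc 0 T, ∀ r ∈ Icc 0 T, uIcc s r ⊆ uIcc 0 T := by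
    intro s hs r hr
    rw [← uIcc_of_le hT.le] at hs hr
    exact uIcc_subset_uIcc hs hr
  have h0T : (0 : ℝ) ∈ Icc 0 T := ⟨le_rfl, hT.le⟩
  have hTT : T ∈ Icc 0 T := ⟨hT.le, le_rfl⟩
  have key : ∀ s ∈ Icc 0 T, T - s ≤ 1 → ‖X T - z‖ ≤ ‖X s - z‖ + (∫ t in 0..T, e t) + C := by
    intro s hs hs1
    have e1 : X T = X s + ∫ t in s..T, g t := by
      rw [hX T hTT, hX s hs, add_assoc, intervalIntegral.integral_add_adjacent_intervals
        (hg.mono_set (hsub 0 h0T s hs)) (hg.mono_set (hsub s hs T hTT))]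
    have hes : IntervalIntegrable e volume s T := he.mono_set (hsub s hs T hTT)
    have e2 : ‖∫ t in s..T, g t‖ ≤ ∫ t in s..T, (e t + C) :=
      intervalIntegral.norm_integral_le_of_norm_le hs.2
        (Filter.Eventually.of_forall fun t _ => h2 t) (hes.add intervalIntegrable_const)
    rw [intervalIntegral.integral_add hes intervalIntegrable_const,
      intervalIntegral.integral_const, smul_eq_mul] at e2
    have e3 : (∫ t in s..T, e t) ≤ ∫ t in 0..T, e t := by
      rw [← intervalIntegral.integral_add_adjacent_intervals
        (he.mono_set (hsub 0 h0T s hs)) hes]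
      have := intervalIntegral.integral_nonneg (μ := volume) hs.1 fun t _ => he0 t
      linarith
    have e4 : (T - s) * C ≤ C := by nlinarith
    have e5 : ‖X T - z‖ ≤ ‖X s - z‖ + ‖∫ t in s..T, g t‖ := by
      rw [e1, add_sub_right_comm]
      exact norm_add_le _ _
    linarith
  -- A short interval is compared with its initial point. Otherwise `key` is averaged over the last
  -- unit interval, which keeps the bound free of `T`.
  rcases le_total T 1 with hT1 | hT1
  · have := key 0 h0T (by linarith)
    linarith
  · have hs : ∀ s ∈ Icc (T - 1) T, s ∈ Icc 0 T := fun s hs => ⟨by linarith [hs.1], hs.2⟩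
    have hs1 := hs (T - 1) ⟨le_rfl, by linarith⟩
    have hes : IntervalIntegrable e volume (T - 1) T := he.mono_set (hsub _ hs1 T hTT)
    have e1 : (∫ _ in (T - 1)..T, (‖X T - z‖ - (∫ t in 0..T, e t) - 2 * C)) ≤
        ∫ t in (T - 1)..T, e t := by
      apply intervalIntegral.integral_mono_on (by linarith) intervalIntegrable_const hes
      intro s hs2
      have := key s (hs s hs2) (by linarith [hs2.1])
      have := h1 s
      linarith
    rw [intervalIntegral.integral_const, smul_eq_mul, sub_sub_cancel, one_mul] at e1
    have e3 : (∫ t in (T - 1)..T, e t) ≤ ∫ t in 0..T, e t := by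
      rw [← intervalIntegral.integral_add_adjacent_intervals
        (he.mono_set (hsub 0 h0T _ hs1)) hes]
      have := intervalIntegral.integral_nonneg (μ := volume) hs1.1 fun t _ => he0 t
      linarith
    have := norm_nonneg (X 0 - z)
    linarith

/-- Solutions of the integral form of a linear equation coincide with the differentiable ones. -/
theorem eqOn_of_integral_equation {N : Type*} [NormedAddCommGroup N] [NormedSpace ℝ N]
    [CompleteSpace N] (M : N →L[ℝ] N) {T : ℝ} (hT : 0 < T) {y z : ℝ → N}
    (hy : ContinuousOn y (Icc 0 T)) (hyi : ∀ t ∈ Icc 0 T, y t = y 0 + ∫ s in 0..t, M (y s))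
    (hz : ∀ t, HasDerivAt z (M (z t)) t) (h0 : y 0 = z 0) : EqOn y z (Icc 0 T) := by
  -- Extending `M ∘ y` by constants outside `[0, T]` gives a continuous integrand, whose primitive
  -- is differentiable everywhere and agrees with `y` on `[0, T]`.
  set g : ℝ → N := IccExtend hT.le ((Icc 0 T).domRestrict fun t => M (y t)) with hg
  have hgc : Continuous g :=
    (continuousOn_iff_continuous_domRestrict.1 (M.continuous.comp_continuousOn hy)).Icc_extend'
  have hgy : ∀ t ∈ Icc 0 T, g t = M (y t) := fun t ht => IccExtend_of_mem _ _ ht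
  set F : ℝ → N := fun t => y 0 + ∫ s in 0..t, g s with hF
  have hFd : ∀ t, HasDerivAt F (g t) t := fun t =>
    (hgc.integral_hasStrictDerivAt 0 t).hasDerivAt.const_add _
  have hFy : ∀ t ∈ Icc 0 T, F t = y t := by
    intro t ht
    rw [hyi t ht, hF]
    simp only
    congr 1
    apply intervalIntegral.integral_congr
    intro s hs
    rw [uIcc_of_le ht.1] at hs
    exact hgy s ⟨hs.1, hs.2.trans ht.2⟩
  have h1 : EqOn F z (Icc 0 T) := by
    refine ODE_solution_unique (v := fun _ => M) (K := ‖M‖₊) (fun _ => M.lipschitz)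
      (fun t _ => (hFd t).continuousAt.continuousWithinAt) (fun t ht => ?_)
      (fun t _ => (hz t).continuousAt.continuousWithinAt)
      (fun t _ => (hz t).hasDerivWithinAt) ?_
    · have ht' : t ∈ Icc 0 T := ⟨ht.1, ht.2.le⟩
      rw [hFy t ht', ← hgy t ht']
      exact (hFd t).hasDerivWithinAt
    · rw [hFy 0 ⟨le_rfl, hT.le⟩, h0]
  intro t ht
  rw [← hFy t ht, h1 ht]

/-- The linear map `toEuclideanLin M` as a continuous linear map. -/
def euclideanCLM {a b : ℕ} (M : Matrix (Fin a) (Fin b) ℝ) : E b →L[ℝ] E a :=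
  LinearMap.toContinuousLinearMap (toEuclideanLin M)

theorem euclideanCLM_apply {a b : ℕ} (M : Matrix (Fin a) (Fin b) ℝ) (y : E b) :
    euclideanCLM M y = toEuclideanLin M y := rfl

theorem continuous_toEuclideanLin {a b : ℕ} (M : Matrix (Fin a) (Fin b) ℝ) :
    Continuous fun y : E b => toEuclideanLin M y := (euclideanCLM M).continuous

section Trajectory

variable {A : Matrix (Fin n) (Fin n) ℝ} {B : Matrix (Fin n) (Fin m) ℝ} {b x : E n} {T : ℝ}
  {u : ℝ → E m} {X : ℝ → E n}

theorem intervalIntegrable_of_continuousOn_Icc {N : Type*} [NormedAddCommGroup N] {g : ℝ → N}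
    (hT : 0 < T) (hg : ContinuousOn g (Icc 0 T)) : IntervalIntegrable g volume 0 T := by
  apply ContinuousOn.intervalIntegrable
  rwa [uIcc_of_le hT.le]

theorem intervalIntegrable_control (hT : 0 < T) (hu : MemLp u 2 (volume.restrict (Icc 0 T))) :
    IntervalIntegrable u volume 0 T := by
  rw [intervalIntegrable_iff_integrableOn_Icc_of_le hT.le]
  exact hu.integrable (by norm_num)

theorem intervalIntegrable_control_sq (hT : 0 < T) (hu : MemLp u 2 (volume.restrict (Icc 0 T)))
    (u₀ : E m) : IntervalIntegrable (fun t => ‖u t - u₀‖ ^ 2) volume 0 T := by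
  rw [intervalIntegrable_iff_integrableOn_Icc_of_le hT.le]
  exact (hu.sub (memLp_const u₀)).integrable_norm_pow (by norm_num)

theorem IsTrajectory.intervalIntegrable (hT : 0 < T)
    (hu : MemLp u 2 (volume.restrict (Icc 0 T))) (hX : IsTrajectory A B b x T u X) :
    IntervalIntegrable (fun s => toEuclideanLin A (X s) + toEuclideanLin B (u s) + b)
      volume 0 T := by
  refine (IntervalIntegrable.add ?_ ?_).add intervalIntegrable_const
  · exact intervalIntegrable_of_continuousOn_Icc hT
      ((continuous_toEuclideanLin A).comp_continuousOn hX.1)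
  · have h := intervalIntegrable_control hT hu
    rw [intervalIntegrable_iff] at h ⊢
    exact (euclideanCLM B).integrable_comp h

theorem IsTrajectory.apply_zero (hT : 0 < T) (hX : IsTrajectory A B b x T u X) : X 0 = x := by
  rw [hX.2 0 ⟨le_rfl, hT.le⟩]
  simp

/-- The uncontrollable component of a trajectory does not depend on the control. -/
theorem IsTrajectory.uncontrollable_eq
    (v : OrthonormalBasis (Fin l) ℝ ↥(controllableSubspace A B)ᗮ) (hT : 0 < T)
    (hu : MemLp u 2 (volume.restrict (Icc 0 T))) (hX : IsTrajectory A B b x T u X)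
    {z : E n} {u₀ : E m} (hz : toEuclideanLin A z + toEuclideanLin B u₀ + b = 0)
    {ξ : ℝ → E n} {w : ℝ → E m} (hξ0 : ξ 0 = x - z)
    (hξ : ∀ t, HasDerivAt ξ (toEuclideanLin A (ξ t) + toEuclideanLin B (w t)) t)
    {t : ℝ} (ht : t ∈ Icc 0 T) :
    toEuclideanLin (columns v)ᵀ (X t - z) = toEuclideanLin (columns v)ᵀ (ξ t) := by
  set M := uncontrollableBlock A (columns v) with hM
  -- Subtracting `z` removes the drift `b`, and `P₂ᵀ B = 0` removes the control: both sides solve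
  -- `y' = A₂₂ y` with the same initial value.
  have hb : toEuclideanLin (columns v)ᵀ b = -toEuclideanLin M (toEuclideanLin (columns v)ᵀ z) := by
    have h := congrArg (toEuclideanLin (columns v)ᵀ) hz
    rw [map_add, map_add, columns_transpose_system_apply, columns_transpose_input_apply, add_zero,
      map_zero] at h
    exact eq_neg_of_add_eq_zero_right h
  have hgi := hX.intervalIntegrable hT hu
  refine eqOn_of_integral_equation (euclideanCLM M) hT
    (y := fun t => toEuclideanLin (columns v)ᵀ (X t - z))
    (z := fun t => toEuclideanLin (columns v)ᵀ (ξ t)) ?_ ?_ ?_ ?_ ht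
  · exact (continuous_toEuclideanLin _).comp_continuousOn (hX.1.sub continuousOn_const)
  · intro t ht
    have hgt : IntervalIntegrable (fun s => toEuclideanLin A (X s) + toEuclideanLin B (u s) + b)
        volume 0 t := by
      apply hgi.mono_set
      rw [uIcc_of_le ht.1, uIcc_of_le hT.le]
      exact Icc_subset_Icc le_rfl ht.2
    have h1 := (euclideanCLM (columns v)ᵀ).intervalIntegral_comp_comm hgt
    simp only [euclideanCLM_apply] at h1 ⊢
    rw [hX.apply_zero hT, hX.2 t ht, add_sub_right_comm, map_add, ← h1]
    congr 1
    apply intervalIntegral.integral_congr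
    intro s _
    simp only [map_add, map_sub, columns_transpose_system_apply, columns_transpose_input_apply, hb]
    abel
  · intro t
    refine ((euclideanCLM (columns v)ᵀ).hasFDerivAt.comp_hasDerivAt t (hξ t)).congr_deriv ?_
    simp only [euclideanCLM_apply, map_add, columns_transpose_system_apply,
      columns_transpose_input_apply, add_zero, hM]
  · simp only [hX.apply_zero hT, hξ0]

end Trajectory

/-! ### The two bounds for the cost. -/

section Bounds

variable {A : Matrix (Fin n) (Fin n) ℝ} {B : Matrix (Fin n) (Fin m) ℝ} {b x : E n}
  {f : E n × E m → ℝ} {p : E n × E m} {ξ : ℝ → E n} {w : ℝ → E m}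

/-- The cost of every control exceeds the static cost, up to a constant. -/
theorem exists_le_cost (v : OrthonormalBasis (Fin l) ℝ ↥(controllableSubspace A B)ᗮ)
    (hf : IsStronglyConvexC2 f) (hp : toEuclideanLin A p.1 + toEuclideanLin B p.2 + b = 0)
    {ψ₁ : E n →L[ℝ] ℝ} {ψ₂ : E l →L[ℝ] ℝ}
    (hψ : ∀ z w, fderiv ℝ f p (z, w) = ψ₁ (toEuclideanLin A z + toEuclideanLin B w) +
      ψ₂ (toEuclideanLin (columns v)ᵀ z))
    (hξ0 : ξ 0 = x - p.1)
    (hξ : ∀ t, HasDerivAt ξ (toEuclideanLin A (ξ t) + toEuclideanLin B (w t)) t)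
    (hξd : ExpDecay ξ) :
    ∃ K : ℝ, ∀ T, 0 < T → ∀ u : ℝ → E m, MemLp u 2 (volume.restrict (Icc 0 T)) →
      ∀ X, IsTrajectory A B b x T u X → ((T * f p - K : ℝ) : EReal) ≤ cost f T u X := by
  obtain ⟨hf2, δ, hδ0, hδ⟩ := hf
  have hξc : Continuous ξ := continuous_iff_continuousAt.2 fun t => (hξ t).continuousAt
  obtain ⟨K₁, hK₁, hξi⟩ := hξd.exists_integral_le hξc
  set κ := ‖ψ₂‖ * ‖euclideanCLM (columns v)ᵀ‖ with hκ
  set M := ‖euclideanCLM A‖ + ‖euclideanCLM B‖ + 1 with hM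
  have hA0 := norm_nonneg (euclideanCLM A)
  have hB0 := norm_nonneg (euclideanCLM B)
  have hM1 : 1 ≤ M := by linarith
  -- The endpoint estimate contributes `2 ‖ψ₁‖ ε ∫ e`; this choice keeps it below `(δ / 2) ∫ e`.
  set ε := δ / (4 * (‖ψ₁‖ + 1)) with hε
  have hε0 : 0 < ε := by positivity
  set C := M ^ 2 / ε with hC
  have hC0 : 0 ≤ C := by positivity
  -- Young's inequality. Since `M` dominates `1`, `‖A‖` and `‖B‖`, it controls both the distance to
  -- `p.1` and the speed.
  have hyoung : ∀ r s : ℝ, M * (r + s) ≤ ε * (r ^ 2 + s ^ 2) + C := by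
    intro r s
    have e1 : C * ε = M ^ 2 := div_mul_cancel₀ _ hε0.ne'
    have e2 : 0 ≤ ε * (ε * (r ^ 2 + s ^ 2) + C - M * (r + s)) := by
      nlinarith [sq_nonneg (ε * r - M / 2), sq_nonneg (ε * s - M / 2), sq_nonneg M]
    have := nonneg_of_mul_nonneg_right e2 hε0
    linarith
  refine ⟨‖ψ₁‖ * (2 * C + 2 * ‖x - p.1‖) + κ * K₁, fun T hT u hu X hX => ?_⟩
  unfold cost
  split_ifs with hint
  swap
  · exact le_top
  rw [EReal.coe_le_coe_iff]
  set e : ℝ → ℝ := fun t => ‖X t - p.1‖ ^ 2 + ‖u t - p.2‖ ^ 2 with he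
  have hei : IntervalIntegrable e volume 0 T :=
    (intervalIntegrable_of_continuousOn_Icc hT
      ((hX.1.sub continuousOn_const).norm.pow 2)).add (intervalIntegrable_control_sq hT hu p.2)
  set g : ℝ → E n := fun s => toEuclideanLin A (X s) + toEuclideanLin B (u s) + b with hg
  have hgi : IntervalIntegrable g volume 0 T := hX.intervalIntegrable hT hu
  have hgeq : ∀ t, g t = toEuclideanLin A (X t - p.1) + toEuclideanLin B (u t - p.2) := by
    intro t
    rw [← sub_zero (g t), ← hp, map_sub, map_sub]
    simp only [hg]
    abel
  have hX0 : X 0 = x := hX.apply_zero hT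
  have hend : ‖X T - p.1‖ ≤ 2 * (∫ t in 0..T, ε * e t) + 2 * C + ‖X 0 - p.1‖ := by
    refine norm_endpoint_sub_le hT hC0 (hei.const_mul ε) (fun t => by positivity) hgi
      (fun t ht => by rw [hX0]; exact hX.2 t ht) (fun t => ?_) (fun t => ?_)
    · have h1 := hyoung ‖X t - p.1‖ ‖u t - p.2‖
      have h2 := norm_nonneg (X t - p.1)
      have h3 := norm_nonneg (u t - p.2)
      nlinarith
    · have h1 := hyoung ‖X t - p.1‖ ‖u t - p.2‖
      rw [hgeq]
      have h2 := (euclideanCLM A).le_opNorm (X t - p.1)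
      have h3 := (euclideanCLM B).le_opNorm (u t - p.2)
      rw [euclideanCLM_apply] at h2 h3
      have h4 := norm_add_le (toEuclideanLin A (X t - p.1)) (toEuclideanLin B (u t - p.2))
      have h5 := norm_nonneg (X t - p.1)
      have h6 := norm_nonneg (u t - p.2)
      nlinarith
  rw [intervalIntegral.integral_const_mul, hX0] at hend
  have hpt : ∀ t ∈ Icc 0 T, f p + ψ₁ (g t) - κ * ‖ξ t‖ + δ / 2 * e t ≤ f (X t, u t) := by
    intro t ht
    have h1 := le_of_hessian_ge hf2 hδ p (X t - p.1, u t - p.2)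
    rw [hψ, ← hgeq, hX.uncontrollable_eq v hT hu hp hξ0 hξ ht] at h1
    have h2 : p + (X t - p.1, u t - p.2) = (X t, u t) := by ext1 <;> simp
    rw [h2] at h1
    have h3 := neg_le_of_abs_le (ψ₂.le_opNorm (toEuclideanLin (columns v)ᵀ (ξ t)))
    have h4 := mul_le_mul_of_nonneg_left ((euclideanCLM (columns v)ᵀ).le_opNorm (ξ t))
      (norm_nonneg ψ₂)
    rw [euclideanCLM_apply, ← mul_assoc] at h4
    simp only at h1
    linarith
  have hψi : IntervalIntegrable (fun t => ψ₁ (g t)) volume 0 T := by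
    rw [intervalIntegrable_iff] at hgi ⊢
    exact ψ₁.integrable_comp hgi
  have hξi' : IntervalIntegrable (fun t => κ * ‖ξ t‖) volume 0 T :=
    (continuous_const.mul hξc.norm).intervalIntegrable _ _
  have hI := intervalIntegral.integral_mono_on hT.le
    (((intervalIntegrable_const.add hψi).sub hξi').add (hei.const_mul (δ / 2))) hint hpt
  rw [intervalIntegral.integral_add ((intervalIntegrable_const.add hψi).sub hξi')
    (hei.const_mul _), intervalIntegral.integral_sub (intervalIntegrable_const.add hψi) hξi',
    intervalIntegral.integral_add intervalIntegrable_const hψi, intervalIntegral.integral_const,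
    intervalIntegral.integral_const_mul, intervalIntegral.integral_const_mul, sub_zero, smul_eq_mul,
    ψ₁.intervalIntegral_comp_comm hgi] at hI
  have hXT : (∫ t in 0..T, g t) = (X T - p.1) - (x - p.1) := by
    rw [hX.2 T ⟨hT.le, le_rfl⟩]
    abel
  have hψX : -(‖ψ₁‖ * (‖X T - p.1‖ + ‖x - p.1‖)) ≤ ψ₁ (∫ t in 0..T, g t) := by
    rw [hXT]
    refine neg_le_of_abs_le ((ψ₁.le_opNorm _).trans ?_)
    exact mul_le_mul_of_nonneg_left (norm_sub_le _ _) (norm_nonneg _)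
  have hE : 0 ≤ ∫ t in 0..T, e t :=
    intervalIntegral.integral_nonneg hT.le fun t _ => by positivity
  have hκ0 : 0 ≤ κ := by positivity
  have h5 := mul_le_mul_of_nonneg_left (hξi T hT.le) hκ0
  have h6 := mul_le_mul_of_nonneg_left hend (norm_nonneg ψ₁)
  have h7 : 2 * ‖ψ₁‖ * ε ≤ δ / 2 := by
    have : 4 * (‖ψ₁‖ + 1) * ε = δ := by
      rw [hε]
      field_simp
    nlinarith
  have h8 := mul_le_mul_of_nonneg_right h7 hE
  nlinarith

/-- A decaying deviation from a steady pair yields a control whose cost is at most the static cost,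
up to a constant. -/
theorem exists_valueFunction_le (hf : ContDiff ℝ 2 f)
    (hp : toEuclideanLin A p.1 + toEuclideanLin B p.2 + b = 0) (hw : Continuous w)
    (hξ0 : ξ 0 = x - p.1)
    (hξ : ∀ t, HasDerivAt ξ (toEuclideanLin A (ξ t) + toEuclideanLin B (w t)) t)
    (hξd : ExpDecay ξ) (hwd : ExpDecay w) :
    ∃ K : ℝ, ∀ T, 0 < T → valueFunction A B b f T x ≤ ((T * f p + K : ℝ) : EReal) := by
  have hξc : Continuous ξ := continuous_iff_continuousAt.2 fun t => (hξ t).continuousAt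
  obtain ⟨K₁, hK₁, hξi⟩ := hξd.exists_integral_le hξc
  obtain ⟨K₂, hK₂, hwi⟩ := hwd.exists_integral_le hw
  have hbdd : ∀ {F : Type} [NormedAddCommGroup F] {g : ℝ → F}, ExpDecay g →
      ∃ C, ∀ t, 0 ≤ t → ‖g t‖ ≤ C := by
    intro F _ g hg
    obtain ⟨C, α, hC, hα, h⟩ := hg.exists_nonneg
    refine ⟨C, fun t ht => (h t ht).trans ?_⟩
    have : Real.exp (-α * t) ≤ 1 := Real.exp_le_one_iff.2 (by nlinarith)
    nlinarith
  obtain ⟨C₁, hC₁⟩ := hbdd hξd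
  obtain ⟨C₂, hC₂⟩ := hbdd hwd
  set R := max C₁ C₂ with hR
  have hR0 : 0 ≤ R := ((norm_nonneg _).trans (hC₁ 0 le_rfl)).trans (le_max_left _ _)
  -- The deviation `(ξ, w)` stays within distance `R` for all times, so one Lipschitz constant
  -- serves every `T`.
  obtain ⟨L, hL⟩ := (isCompact_closedBall p R).exists_bound_of_continuousOn
    (hf.continuous_fderiv (by norm_num)).continuousOn
  have hL0 : 0 ≤ L := (norm_nonneg _).trans (hL p (Metric.mem_closedBall_self hR0))
  have hlip : ∀ t, 0 ≤ t → f (p + (ξ t, w t)) ≤ f p + L * (‖ξ t‖ + ‖w t‖) := by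
    intro t ht
    have hmem : p + (ξ t, w t) ∈ Metric.closedBall p R := by
      rw [mem_closedBall_iff_norm, add_sub_cancel_left, Prod.norm_def]
      exact max_le ((hC₁ t ht).trans (le_max_left _ _)) ((hC₂ t ht).trans (le_max_right _ _))
    have h1 := (convex_closedBall p R).norm_image_sub_le_of_norm_fderiv_le (𝕜 := ℝ)
      (fun q _ => (hf.differentiable (by norm_num)) q) hL (Metric.mem_closedBall_self hR0) hmem
    rw [add_sub_cancel_left] at h1
    have h2 : ‖(ξ t, w t)‖ ≤ ‖ξ t‖ + ‖w t‖ := by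
      rw [Prod.norm_def]
      exact max_le_add_of_nonneg (norm_nonneg _) (norm_nonneg _)
    have h3 := le_of_abs_le h1
    have h4 := mul_le_mul_of_nonneg_left h2 hL0
    linarith
  refine ⟨L * (K₁ + K₂), fun T hT => ?_⟩
  have hX : IsTrajectory A B b x T (fun t => p.2 + w t) (fun t => p.1 + ξ t) := by
    refine ⟨(continuous_const.add hξc).continuousOn, fun t _ => ?_⟩
    have h1 : ∀ s, toEuclideanLin A (p.1 + ξ s) + toEuclideanLin B (p.2 + w s) + b =
        toEuclideanLin A (ξ s) + toEuclideanLin B (w s) := by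
      intro s
      rw [← zero_add (toEuclideanLin A (ξ s) + toEuclideanLin B (w s)), ← hp, map_add, map_add]
      abel
    simp only [h1]
    rw [intervalIntegral.integral_eq_sub_of_hasDerivAt (fun s _ => hξ s), hξ0]
    · abel
    · exact (((continuous_toEuclideanLin A).comp hξc).add
        ((continuous_toEuclideanLin B).comp hw)).intervalIntegrable _ _
  have hu : MemLp (fun t => p.2 + w t) 2 (volume.restrict (Icc 0 T)) := by
    obtain ⟨C, hC⟩ := isCompact_Icc.exists_bound_of_continuousOn
      (continuous_const.add hw : Continuous fun t => p.2 + w t).continuousOn (s := Icc 0 T)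
    refine MemLp.of_bound (continuous_const.add hw).aestronglyMeasurable C ?_
    exact (ae_restrict_iff' measurableSet_Icc).2 (Filter.Eventually.of_forall hC)
  refine (iInf₂_le_of_le (fun t => p.2 + w t) hu
    (iInf₂_le (fun t => p.1 + ξ t) hX)).trans ?_
  have hfc : Continuous fun t => f (p + (ξ t, w t)) :=
    hf.continuous.comp (continuous_const.add (hξc.prodMk hw))
  have hfi : IntervalIntegrable (fun t => f (p + (ξ t, w t))) volume 0 T :=
    hfc.intervalIntegrable _ _
  unfold cost
  rw [if_pos (show IntervalIntegrable (fun t => f (p.1 + ξ t, p.2 + w t)) volume 0 T from hfi),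
    EReal.coe_le_coe_iff]
  have hξi' : IntervalIntegrable (fun t => ‖ξ t‖) volume 0 T := hξc.norm.intervalIntegrable _ _
  have hwi' : IntervalIntegrable (fun t => ‖w t‖) volume 0 T := hw.norm.intervalIntegrable _ _
  have hI := intervalIntegral.integral_mono_on hT.le hfi
    (intervalIntegrable_const.add ((hξi'.add hwi').const_mul L)) fun t ht => hlip t ht.1
  rw [intervalIntegral.integral_add intervalIntegrable_const ((hξi'.add hwi').const_mul L),
    intervalIntegral.integral_const, intervalIntegral.integral_const_mul,
    intervalIntegral.integral_add hξi' hwi', sub_zero, smul_eq_mul] at hI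
  refine hI.trans ?_
  have := mul_le_mul_of_nonneg_left (add_le_add (hξi T hT.le) (hwi T hT.le)) hL0
  linarith

end Bounds

end Turnpike
end

/-! ### The turnpike estimate for the value function. -/

theorem mainTheorem3 {n m l : ℕ} (A : Matrix (Fin n) (Fin n) ℝ) (B : Matrix (Fin n) (Fin m) ℝ)
    (b : Turnpike.E n)
    (f : Turnpike.E n × Turnpike.E m → ℝ)
    -- an orthonormal basis of the orthogonal complement of the controllable subspace
    (v : OrthonormalBasis (Fin l) ℝ ↥(Turnpike.controllableSubspace A B)ᗮ)
    (P₂ : Matrix (Fin n) (Fin l) ℝ) (hP₂ : P₂ = Turnpike.columns v)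
    -- `b ∈ im (A, B)`
    (hA1 : ∃ (z : Turnpike.E n) (w : Turnpike.E m),
      b = Matrix.toEuclideanLin A z + Matrix.toEuclideanLin B w)
    (hA2 : Turnpike.IsStronglyConvexC2 f)
    (c : Turnpike.E l)
    (hc : Matrix.toEuclideanLin (Turnpike.uncontrollableBlock A P₂) c =
      Matrix.toEuclideanLin P₂ᵀ b)
    (x : Turnpike.E n) (hx : x ∈ Turnpike.feasibleStates A P₂ c) :
    -- `V*(x)` is a real number, and so is `V_T(x)` for each `T > 0`
    ∃ (Vstar : ℝ) (V : ℝ → ℝ),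
      Turnpike.staticValue A B b f P₂ c x hx = (Vstar : EReal) ∧
      (∀ T : ℝ, 0 < T → Turnpike.valueFunction A B b f T x = (V T : EReal)) ∧
      (∃ K : ℝ, 0 < K ∧ ∀ T : ℝ, 0 < T → |V T - T * Vstar| ≤ K) ∧
      (fun T : ℝ => V T / T - Vstar) =O[Filter.atTop] (fun T : ℝ => 1 / T) := by
  subst hP₂
  open Turnpike in
  have hclosed : IsClosed (steadyPairs A B b (columns v) c x hx) := by
    refine IsClosed.inter (isClosed_eq ?_ continuous_const) (isClosed_eq ?_ continuous_const)
    · exact (((continuous_toEuclideanLin A).comp continuous_fst).add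
        ((continuous_toEuclideanLin B).comp continuous_snd)).add continuous_const
    · exact ((continuous_toEuclideanLin _).comp continuous_fst).add continuous_const
  obtain ⟨p, hp, hmin⟩ := Turnpike.exists_isMinOn_of_isStronglyConvexC2 hA2 hclosed
    (Turnpike.steadyPairs_nonempty v hA1 hc hx)
  obtain ⟨ψ₁, ψ₂, hψ⟩ := Turnpike.exists_multipliers (hA2.1.differentiable (by norm_num)) hp hmin
  -- `P₂ᵀ (x - p.1)` is `P₂ᵀ x + c` minus its projection to the kernel along the stable subspace;
  -- the shift `c` cancels.
  have hstable : Matrix.toEuclideanLin (Turnpike.columns v)ᵀ (x - p.1) ∈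
      Turnpike.stableSubspace (Turnpike.uncontrollableBlock A (Turnpike.columns v)) := by
    have h1 := Turnpike.sub_kernelProj_mem hx
    rw [← hp.2, add_sub_add_right_eq_sub, ← map_sub] at h1
    exact h1
  obtain ⟨ξ, w, hw, hξ0, hξ, hξd, hwd⟩ := Turnpike.exists_decaying_trajectory v hstable
  obtain ⟨K₁, hK₁⟩ := Turnpike.exists_le_cost v hA2 hp.1 hψ hξ0 hξ hξd
  obtain ⟨K₂, hK₂⟩ := Turnpike.exists_valueFunction_le hA2.1 hp.1 hw hξ0 hξ hξd hwd
  have hlow : ∀ T : ℝ, 0 < T →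
      ((T * f p - K₁ : ℝ) : EReal) ≤ Turnpike.valueFunction A B b f T x := fun T hT =>
    le_iInf₂ fun u hu => le_iInf₂ fun X hX => hK₁ T hT u hu X hX
  have hV : ∀ T : ℝ, 0 < T → Turnpike.valueFunction A B b f T x =
      ((Turnpike.valueFunction A B b f T x).toReal : EReal) := by
    intro T hT
    refine (EReal.coe_toReal ?_ ?_).symm
    · exact ((hK₂ T hT).trans_lt (EReal.coe_lt_top _)).ne
    · exact ((EReal.bot_lt_coe _).trans_le (hlow T hT)).ne'
  have hK : ∀ T : ℝ, 0 < T → |(Turnpike.valueFunction A B b f T x).toReal - T * f p| ≤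
      -- The summand `1` only makes the constant positive.
      |K₁| + |K₂| + 1 := by
    intro T hT
    have h1 := hlow T hT
    have h2 := hK₂ T hT
    rw [hV T hT, EReal.coe_le_coe_iff] at h1 h2
    rw [abs_le]
    constructor <;> linarith [le_abs_self K₁, le_abs_self K₂, abs_nonneg K₁, abs_nonneg K₂]
  refine ⟨f p, fun T => (Turnpike.valueFunction A B b f T x).toReal, ?_, hV,
    ⟨|K₁| + |K₂| + 1, by positivity, hK⟩, ?_⟩
  · refine le_antisymm (iInf₂_le p hp) (le_iInf₂ fun q hq => ?_)
    exact EReal.coe_le_coe_iff.2 (hmin hq)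
  · refine Asymptotics.IsBigO.of_bound (|K₁| + |K₂| + 1) ?_
    filter_upwards [Filter.eventually_gt_atTop 0] with T hT
    have h1 : (Turnpike.valueFunction A B b f T x).toReal / T - f p =
        ((Turnpike.valueFunction A B b f T x).toReal - T * f p) * (1 / T) := by
      field_simp
    rw [h1, norm_mul]
    exact mul_le_mul_of_nonneg_right (hK T hT) (norm_nonneg _)
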